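/- Consider the focusing quintic nonlinear Schrödinger equation on $\mathbb{R}^2$, $$ i\partial_t u+\Delta u+|u|^4u=0,\qquad u(x,0)=u_0(x)\in H^1(\mathbb{R}^2), \tag{1}$$ where, for a time interval $I\ni 0$, an $H^1$ solution on $I$ is a function $u\in C(I;H^1(\mathbb{R}^2))$ with $u(0)=u_0$ that satisfies the equation in the sense of distributions on $\mathbb{R}^2$ at every time of $I$ (with one-sided time derivatives at an endpoint of $I$). A pair $(q,r)$ is called $\dot H^{1/2}$-admissible if $\frac2q+\frac2r=\frac12$, $2\le q,r\le\infty$ and $(q,r)\ne(2,\infty)$. Fix a number $4^+\in(4,6]$, put $(4^+)'=\frac{4\cdot 4^+}{4^+-4}$ (so that $\frac14=\frac1{(4^+)'}+\frac1{4^+}$), and for an interval $I$ let $$\|u\|_{S(\dot H^{1/2};I)}=\sup\Big\{\|u\|_{L^q_t(I;L^r_x(\mathbb{R}^2))}:\ (q,r)\ \dot H^{1/2}\text{-admissible},\ 4^+\le q\le\infty,\ 4^+\le r\le(4^+)'\Big\}.$$ **Proposition ($H^1$ scattering).** Let $u_0\in H^1(\mathbb{R}^2)$. (i) If $u$ is an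 $H^1$ solution of (1) on $[0,+\infty)$ (in particular, if $u$ is the restriction to $[0,+\infty)$ of a solution on all of $\mathbb{R}$) with $\|u\|_{S(\dot H^{1/2};[0,+\infty))}<+\infty$ and $\sup_{t\in[0,+\infty)}\|u(t)\|_{H^1}\le B$ for some $B<+\infty$, then there exists $\phi_+\in H^1(\mathbb{R}^2)$ such that $$\lim_{t\to+\infty}\|u(t)-e^{it\Delta}\phi_+\|_{H^1}=0 .$$ (ii) If $u$ is an $H^1$ solution of (1) on $(-\infty,0]$ with $\|u\|_{S(\dot H^{1/2};(-\infty,0])}<+\infty$ and $\sup_{t\in(-\infty,0]}\|u(t)\|_{H^1}\le B$ for some $B<+\infty$, then there exists $\phi_-\in H^1(\mathbb{R}^2)$ such that $$\lim_{t\to-\infty}\|u(t)-e^{it\Delta}\phi_-\|_{H^1}=0 .$$ -/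

import Mathlib

open MeasureTheory Filter Topology
open scoped ENNReal NNReal FourierTransform SchwartzMap TemperedDistribution Laplacian

noncomputable section

namespace QuinticNLS

/-- The plane `ℝ²` with its Euclidean norm and Lebesgue measure. -/
abbrev Plane : Type := EuclideanSpace ℝ (Fin 2)

/-- Complex-valued `L²(ℝ²)`. -/
abbrev L2 : Type := Lp ℂ 2 (volume : Measure Plane)

/-- Membership in the Sobolev space `H¹(ℝ²)`. -/
def InH1 (f : L2) : Prop :=
  TemperedDistribution.MemSobolev 1 2 (f : 𝓢'(Plane, ℂ))

/-- The `H¹` norm `(‖f‖² + ‖∇f‖²)^{1/2}` in `L²`, written by Plancherel as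
`(∫ (1 + (2π|ξ|)²) |𝓕 f(ξ)|² dξ)^{1/2}`, with `𝓕 f(ξ) = ∫ e^{-2πi x·ξ} f(x) dx`.
It is finite exactly when `f ∈ H¹` (`inH1_iff`). -/
def h1Norm (f : L2) : ℝ≥0∞ :=
  eLpNorm (fun ξ : Plane => ((Real.sqrt (1 + (2 * Real.pi * ‖ξ‖) ^ 2) : ℝ) : ℂ)
    * (𝓕 f : L2) ξ) 2 volume

lemma hasTemperateGrowth_weight (s : ℝ) :
    (fun ξ : Plane => (((1 + ‖ξ‖ ^ 2) ^ s : ℝ) : ℂ)).HasTemperateGrowth := by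
  fun_prop

lemma exists_weight_iff (F : L2) :
    (∃ f' : L2, TemperedDistribution.smulLeftCLM ℂ (fun ξ : Plane => (((1 + ‖ξ‖ ^ 2) ^ ((1 : ℝ) / 2) : ℝ) : ℂ))
      (F : 𝓢'(Plane, ℂ)) = f') ↔
    MemLp (fun ξ : Plane => (((1 + ‖ξ‖ ^ 2) ^ ((1 : ℝ) / 2) : ℝ) : ℂ) * F ξ) 2 volume := by
  constructor
  · rintro ⟨f', hf'⟩
    have hg' : MemLp (fun ξ : Plane => (((1 + ‖ξ‖ ^ 2) ^ (-(1 / 2) : ℝ) : ℝ) : ℂ)) ∞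
        (volume : Measure Plane) := by
      refine memLp_top_of_bound ?_ 1 (Eventually.of_forall fun ξ => ?_)
      · exact (hasTemperateGrowth_weight _).1.continuous.aestronglyMeasurable
      · rw [Complex.norm_real, Real.norm_of_nonneg (by positivity)]
        exact Real.rpow_le_one_of_one_le_of_nonpos (by nlinarith [sq_nonneg ‖ξ‖]) (by norm_num)
    have h1 := Lp.toTemperedDistribution_smul_eq (r := 2) (hasTemperateGrowth_weight (-(1 / 2)))
      hg' f'
    rw [← hf', TemperedDistribution.smulLeftCLM_smulLeftCLM_apply (hasTemperateGrowth_weight _)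
      (hasTemperateGrowth_weight _)] at h1
    have h2 : (fun ξ : Plane => (((1 + ‖ξ‖ ^ 2) ^ ((1 : ℝ) / 2) : ℝ) : ℂ)) *
        (fun ξ : Plane => (((1 + ‖ξ‖ ^ 2) ^ (-(1 / 2) : ℝ) : ℝ) : ℂ)) = fun _ => 1 := by
      ext ξ
      rw [Pi.mul_apply, ← Complex.ofReal_mul, ← Real.rpow_add (by positivity)]
      simp
    rw [h2, TemperedDistribution.smulLeftCLM_const, one_smul] at h1
    have h3 : (hg'.toLp _ • f' : L2) = F := by
      have hk := Lp.ker_toTemperedDistributionCLM_eq_bot (F := ℂ) (μ := (volume : Measure Plane))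
        (p := 2)
      exact (LinearMap.ker_eq_bot.1 hk) h1
    refine (memLp_congr_ae ?_).1 (Lp.memLp f')
    filter_upwards [Lp.coeFn_lpSMul (r := 2) (hg'.toLp _) f', hg'.coeFn_toLp] with ξ ha hb
    rw [← h3, ha, Pi.smul_apply', hb, smul_eq_mul, ← mul_assoc, ← Complex.ofReal_mul,
      ← Real.rpow_add (by positivity)]
    simp
  · intro h
    refine ⟨h.toLp _, ?_⟩
    ext φ
    simp only [Lp.toTemperedDistribution_apply,
      TemperedDistribution.smulLeftCLM_apply_apply]
    apply integral_congr_ae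
    filter_upwards [h.coeFn_toLp] with ξ hξ
    rw [hξ, SchwartzMap.smulLeftCLM_apply_apply (hasTemperateGrowth_weight _)]
    simp only [smul_eq_mul]
    ring

lemma inH1_iff (f : L2) : InH1 f ↔ h1Norm f < ∞ := by
  have hm : AEStronglyMeasurable (fun ξ : Plane =>
      ((Real.sqrt (1 + (2 * Real.pi * ‖ξ‖) ^ 2) : ℝ) : ℂ) * (𝓕 f : L2) ξ) volume := by
    refine Continuous.aestronglyMeasurable ?_ |>.mul (Lp.aestronglyMeasurable _)
    fun_prop
  have hm' : AEStronglyMeasurable (fun ξ : Plane =>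
      (((1 + ‖ξ‖ ^ 2) ^ ((1 : ℝ) / 2) : ℝ) : ℂ) * (𝓕 f : L2) ξ) volume :=
    (hasTemperateGrowth_weight _).1.continuous.aestronglyMeasurable.mul
      (Lp.aestronglyMeasurable _)
  have hpi : 1 ≤ 2 * Real.pi := by linarith [Real.pi_gt_three]
  have key := exists_weight_iff (𝓕 f)
  rw [← Lp.fourier_toTemperedDistribution_eq] at key
  unfold InH1
  rw [TemperedDistribution.memSobolev_iff_exists_smulLeftCLM_fourier]
  refine key.trans ?_
  constructor
  · intro h
    refine (h.of_le_mul (c := 2 * Real.pi) hm (Eventually.of_forall fun ξ => ?_)).2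
    rw [norm_mul, norm_mul, ← mul_assoc, Complex.norm_real, Complex.norm_real,
      Real.norm_of_nonneg (by positivity), Real.norm_of_nonneg (by positivity),
      ← Real.sqrt_eq_rpow]
    refine mul_le_mul_of_nonneg_right ?_ (norm_nonneg _)
    refine Real.sqrt_le_iff.2 ⟨by positivity, ?_⟩
    rw [mul_pow, mul_pow _ (Real.sqrt _), Real.sq_sqrt (by positivity)]
    nlinarith
  · intro h
    refine MemLp.of_le ⟨hm, h⟩ hm' (Eventually.of_forall fun ξ => ?_)
    rw [norm_mul, norm_mul, Complex.norm_real, Complex.norm_real,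
      Real.norm_of_nonneg (by positivity), Real.norm_of_nonneg (by positivity),
      ← Real.sqrt_eq_rpow]
    refine mul_le_mul_of_nonneg_right (Real.sqrt_le_sqrt ?_) (norm_nonneg _)
    nlinarith [sq_nonneg ‖ξ‖, mul_nonneg (sq_nonneg ‖ξ‖) (by nlinarith : 0 ≤ (2 * Real.pi)^2 - 1)]

/-- The symbol `e^{-it(2π|ξ|)²}` of the free propagator. -/
def schrodingerSymbol (t : ℝ) (ξ : Plane) : ℂ :=
  Complex.exp (((-(t * (2 * Real.pi * ‖ξ‖) ^ 2) : ℝ) : ℂ) * Complex.I)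

lemma continuous_schrodingerSymbol (t : ℝ) : Continuous (schrodingerSymbol t) := by
  unfold schrodingerSymbol
  fun_prop

lemma norm_schrodingerSymbol (t : ℝ) (ξ : Plane) : ‖schrodingerSymbol t ξ‖ = 1 := by
  unfold schrodingerSymbol
  exact Complex.norm_exp_ofReal_mul_I _

lemma memLp_schrodingerSymbol_mul (t : ℝ) (f : L2) :
    MemLp (fun ξ => schrodingerSymbol t ξ * f ξ) 2 (volume : Measure Plane) := by
  refine (Lp.memLp f).of_le
    ((continuous_schrodingerSymbol t).aestronglyMeasurable.mul (Lp.aestronglyMeasurable f))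
    (Eventually.of_forall fun ξ => ?_)
  rw [norm_mul, norm_schrodingerSymbol, one_mul]

/-- The free Schrödinger propagator `e^{itΔ}` on `L²(ℝ²)`. -/
def freeProp (t : ℝ) (f : L2) : L2 :=
  𝓕⁻ ((memLp_schrodingerSymbol_mul t (𝓕 f)).toLp _)

/-- `u` is an `H¹` solution, on the time set `I`, of the Cauchy problem
`i ∂ₜu + Δu + |u|⁴u = 0`, `u(0) = u₀`: it belongs to `C(I; H¹)` and satisfies the equation,
in the form `∂ₜu = i(Δu + |u|⁴u)`, in the sense of distributions on `ℝ²` at every time of `I`. -/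
structure IsSolution (I : Set ℝ) (u₀ : L2) (u : ℝ → L2) : Prop where
  mem : ∀ t ∈ I, InH1 (u t)
  cont : ∀ t ∈ I, Tendsto (fun s => h1Norm (u s - u t)) (𝓝[I] t) (𝓝 0)
  initial : u 0 = u₀
  equation : ∀ φ : 𝓢(Plane, ℂ), ∀ t ∈ I,
    HasDerivWithinAt (fun s => ∫ x, u s x * φ x)
      (Complex.I * ((∫ x, u t x * (Δ φ) x)
        + ∫ x, ((‖u t x‖ ^ 4 : ℝ) : ℂ) * u t x * φ x)) I t

/-- `(q, r)` is `Ḣˢ`-Strichartz admissible in dimension two. -/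
def Admissible (s : ℝ) (q r : ℝ≥0∞) : Prop :=
  2 / q + 2 / r = ENNReal.ofReal (1 - s) ∧ 2 ≤ q ∧ 2 ≤ r ∧ ¬(q = 2 ∧ r = ∞)

/-- The mixed norm `‖u‖_{L^q_t(I; L^r_x)}`. -/
def mixedNorm (I : Set ℝ) (q r : ℝ≥0∞) (u : ℝ → L2) : ℝ≥0∞ :=
  eLpNorm (fun t => eLpNorm (u t) r volume) q (volume.restrict I)

/-- `(a⁺)' = a⁺ a / (a⁺ - a)`, so that `1/a = 1/(a⁺)' + 1/a⁺`; here `ap` stands for `a⁺`. -/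
def plusDual (a ap : ℝ) : ℝ := ap * a / (ap - a)

/-- The Strichartz norm `‖u‖_{S(Ḣ^{1/2})}` over the time set `I`, where `ap` stands for `4⁺`:
the supremum of `‖u‖_{L^q_t L^r_x}` over the `Ḣ^{1/2}`-admissible pairs with
`4⁺ ≤ q ≤ ∞` and `4⁺ ≤ r ≤ (4⁺)'`. -/
def strichartzNorm (ap : ℝ) (I : Set ℝ) (u : ℝ → L2) : ℝ≥0∞ :=
  ⨆ (q : ℝ≥0∞) (r : ℝ≥0∞) (_ : Admissible (1 / 2) q r)
    (_ : ENNReal.ofReal ap ≤ q)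
    (_ : ENNReal.ofReal ap ≤ r ∧ r ≤ ENNReal.ofReal (plusDual 4 ap)),
    mixedNorm I q r u

end QuinticNLS

end

/-!
Scattering follows once the profile `t ↦ e^{-itΔ} u(t)` is shown to be Cauchy in `H¹` along the time
direction considered: its limit in `L²` is the scattering state, it lies in `H¹` by lower
semicontinuity of the norm, and `e^{itΔ}` preserves the `H¹` norm (`exists_scattering_state`).
Among the Strichartz norms only that of `L⁸` in space-time is needed. It is finite, hence small on a
tail of the time interval, and smallness there forces the increments of the profile to be small
(`h1Norm_profile_sub_le`).

The estimates rest on the bound of `e^{itΔ} g` in `L⁴(ℝ × ℝ²)` by `‖g‖` in `L²`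
(`lintegral_eLpNorm_freeProp_le`). The square of a free wave is an oscillatory integral over pairs
of frequencies; with a Gaussian weight in space-time, Schur's test reduces its `L²` norm to an
integral over pairs with nearly equal sums `ξ₁ + ξ₂` and `|ξ₁|² + |ξ₂|²`. In dimension two this
integral is bounded uniformly in the width of the weight (`lintegral_pairKernel_le`).

For a path `v` that solves `∂ₜv = i(Δv + F)` in the sense of distributions, testing with free waves
whose data are Schwartz functions turns the equation into an ordinary differential equation for a
scalar function. By duality the increment of the profile over `[s, t]` is at most the norm of `F` in
`L^{4/3}([s, t] × ℝ²)` (`enorm_profile_sub_le`). Thus the profile is a path in `L²` whose increments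
are controlled by the power `3/4` of those of a monotone function, and approximation by step
functions on dyadic cells carries the `L⁴` bound from fixed data over to such a path
(`lintegral_eLpNorm_freeProp_path_le`). Here `3/4 > 1/4` makes the series converge, as in the lemma
of Christ and Kiselev.

If `‖F(t)‖_{4/3} ≤ k(t) ‖v(t)‖₄` with `k` small in `L²`, these bounds close
(`enorm_profile_sub_le_of_small`). By Hölder's inequality this applies, with `k` a multiple of
`‖u(t)‖₈⁴`, both to `v = u` and to `v = u(· + h) - u`. The second choice replaces the gradient of
the equation: the bounds are linear in `|h|`, and bounded difference quotients characterize `H¹`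
(`enorm_translate_sub_le`, `h1Norm_le_of_translate`), so that neither the differentiability of the
nonlinearity nor any regularity of the solution beyond the definition is used.
-/

noncomputable section

namespace QuinticNLS

/-! ### Schur's test for oscillatory integrals -/

/-- The operator `A ↦ ∫ e(·, v) A(v) dv` into `L²(ν)` is bounded on `L²(μ)` when the kernel
`∫ e(z, v) conj e(z, w) dν(z)` of its composition with the adjoint is dominated by a symmetric
kernel `κ` that satisfies Schur's condition. -/
theorem lintegral_enorm_integral_sq_le_of_schur {Z V : Type*} [MeasurableSpace Z]
    [MeasurableSpace V] (ν : Measure Z) [IsFiniteMeasure ν] (μ : Measure V) [SFinite μ]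
    {e : Z → V → ℂ} (he : Measurable (Function.uncurry e)) (he1 : ∀ z v, ‖e z v‖ ≤ 1)
    {A : V → ℂ} (hA : Integrable A μ) {κ : V → V → ℝ≥0∞} (hκ : Measurable (Function.uncurry κ))
    (hsymm : ∀ v w, κ v w = κ w v)
    (hk : ∀ v w, ‖∫ z, e z v * starRingEnd ℂ (e z w) ∂ν‖ₑ ≤ κ v w)
    {C : ℝ≥0∞} (hC : ∀ v, ∫⁻ w, κ v w ∂μ ≤ C) :
    ∫⁻ z, ‖∫ v, e z v * A v ∂μ‖ₑ ^ 2 ∂ν ≤ C * ∫⁻ v, ‖A v‖ₑ ^ 2 ∂μ := by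
  have hAc : Integrable (fun v => starRingEnd ℂ (A v)) μ :=
    ((Complex.conjLIE.toContinuousLinearEquiv : ℂ ≃L[ℝ] ℂ).integrable_comp_iff).2 hA
  have heA : ∀ z, Integrable (fun v => e z v * A v) μ := fun z =>
    hA.bdd_mul (c := 1) (he.of_uncurry_left).aestronglyMeasurable (Eventually.of_forall (he1 z))
  have heAc : ∀ z, Integrable (fun v => starRingEnd ℂ (e z v * A v)) μ := fun z =>
    ((Complex.conjLIE.toContinuousLinearEquiv : ℂ ≃L[ℝ] ℂ).integrable_comp_iff).2 (heA z)
  -- the square of the oscillatory integral as a double integral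
  have hsq : ∀ z, (((‖∫ v, e z v * A v ∂μ‖ ^ 2 : ℝ)) : ℂ) =
      ∫ p : V × V, (e z p.1 * A p.1) * starRingEnd ℂ (e z p.2 * A p.2) ∂(μ.prod μ) := by
    intro z
    rw [integral_prod_mul (fun v => e z v * A v) (fun w => starRingEnd ℂ (e z w * A w)),
      integral_conj, Complex.mul_conj, Complex.normSq_eq_norm_sq]
  have hbig : Integrable (fun q : Z × (V × V) =>
      (e q.1 q.2.1 * starRingEnd ℂ (e q.1 q.2.2)) * (A q.2.1 * starRingEnd ℂ (A q.2.2)))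
      (ν.prod (μ.prod μ)) := by
    have h0 : Integrable (fun q : Z × (V × V) => (1 : ℂ) * (A q.2.1 * starRingEnd ℂ (A q.2.2)))
        (ν.prod (μ.prod μ)) := (integrable_const (1 : ℂ)).mul_prod (hA.mul_prod hAc)
    simp only [one_mul] at h0
    refine h0.bdd_mul (c := 1) ?_ (Eventually.of_forall fun q => ?_)
    · have h1 : Measurable fun q : Z × (V × V) => e q.1 q.2.1 :=
        he.comp (measurable_fst.prodMk (measurable_fst.comp measurable_snd))
      have h2 : Measurable fun q : Z × (V × V) => e q.1 q.2.2 :=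
        he.comp (measurable_fst.prodMk (measurable_snd.comp measurable_snd))
      exact (h1.mul (Complex.continuous_conj.measurable.comp h2)).aestronglyMeasurable
    · rw [norm_mul, RCLike.norm_conj]
      exact mul_le_one₀ (he1 _ _) (norm_nonneg _) (he1 _ _)
  have hint : Integrable (fun z => ‖∫ v, e z v * A v ∂μ‖ ^ 2) ν := by
    have h1 := hbig.integral_prod_left.re
    refine h1.congr (Eventually.of_forall fun z => ?_)
    have h2 := hsq z
    have h3 : ∫ p : V × V, (e z p.1 * A p.1) * starRingEnd ℂ (e z p.2 * A p.2) ∂(μ.prod μ) =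
      ∫ p : V × V, (e z p.1 * starRingEnd ℂ (e z p.2)) * (A p.1 * starRingEnd ℂ (A p.2))
        ∂(μ.prod μ) := by
      congr 1; ext p; rw [map_mul]; ring
    simp only
    rw [← h3, ← h2]
    exact Complex.ofReal_re _
  have hmain : (((∫ z, ‖∫ v, e z v * A v ∂μ‖ ^ 2 ∂ν : ℝ)) : ℂ) =
      ∫ p : V × V, (∫ z, e z p.1 * starRingEnd ℂ (e z p.2) ∂ν) *
        (A p.1 * starRingEnd ℂ (A p.2)) ∂(μ.prod μ) := by
    rw [← integral_complex_ofReal]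
    simp_rw [← integral_mul_const]
    rw [← integral_integral_swap (f := fun z (p : V × V) =>
      (e z p.1 * starRingEnd ℂ (e z p.2)) * (A p.1 * starRingEnd ℂ (A p.2))) hbig]
    congr 1; ext z
    rw [hsq z]
    congr 1; ext p; rw [map_mul]; ring
  have hAm : AEMeasurable (fun v => ‖A v‖ₑ ^ 2) μ := hA.1.enorm.pow_const 2
  have hLHS : ∫⁻ z, ‖∫ v, e z v * A v ∂μ‖ₑ ^ 2 ∂ν =
      ‖(((∫ z, ‖∫ v, e z v * A v ∂μ‖ ^ 2 ∂ν : ℝ)) : ℂ)‖ₑ := by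
    rw [← ofReal_norm, Complex.norm_real, Real.norm_of_nonneg (by positivity),
      ofReal_integral_eq_lintegral_ofReal hint (Eventually.of_forall fun z => by positivity)]
    congr 1; ext z
    rw [ENNReal.ofReal_pow (norm_nonneg _), ofReal_norm]
  rw [hLHS, hmain]
  refine (enorm_integral_le_lintegral_enorm _).trans ?_
  have hpt : ∀ p : V × V, ‖(∫ z, e z p.1 * starRingEnd ℂ (e z p.2) ∂ν) *
        (A p.1 * starRingEnd ℂ (A p.2))‖ₑ ≤
      2⁻¹ * (κ p.1 p.2 * ‖A p.1‖ₑ ^ 2 + κ p.1 p.2 * ‖A p.2‖ₑ ^ 2) := by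
    intro p
    have hc : ‖starRingEnd ℂ (A p.2)‖ₑ = ‖A p.2‖ₑ := by
      rw [← ofReal_norm, RCLike.norm_conj, ofReal_norm]
    rw [enorm_mul, enorm_mul, hc]
    calc _ ≤ κ p.1 p.2 * (‖A p.1‖ₑ * ‖A p.2‖ₑ) := mul_le_mul' (hk _ _) le_rfl
      _ ≤ κ p.1 p.2 * (2⁻¹ * (‖A p.1‖ₑ ^ 2 + ‖A p.2‖ₑ ^ 2)) := by
        refine mul_le_mul' le_rfl ?_
        have h2 : 2 * (‖A p.1‖ₑ * ‖A p.2‖ₑ) ≤ ‖A p.1‖ₑ ^ 2 + ‖A p.2‖ₑ ^ 2 := by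
          simp only [← ofReal_norm, ← ENNReal.ofReal_pow (norm_nonneg _)]
          rw [← ENNReal.ofReal_mul (norm_nonneg _), ← ENNReal.ofReal_add (by positivity)
            (by positivity), show (2 : ℝ≥0∞) = ENNReal.ofReal 2 by simp,
            ← ENNReal.ofReal_mul (by norm_num)]
          apply ENNReal.ofReal_le_ofReal
          nlinarith [sq_nonneg (‖A p.1‖ - ‖A p.2‖)]
        calc _ = 2⁻¹ * (2 * (‖A p.1‖ₑ * ‖A p.2‖ₑ)) := by
              rw [← mul_assoc, ENNReal.inv_mul_cancel (by norm_num) (by norm_num), one_mul]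
          _ ≤ _ := mul_le_mul' le_rfl h2
      _ = _ := by ring
  refine (lintegral_mono hpt).trans ?_
  have hm1 : AEMeasurable (fun p : V × V => κ p.1 p.2 * ‖A p.1‖ₑ ^ 2) (μ.prod μ) :=
    hκ.aemeasurable.mul (hAm.comp_quasiMeasurePreserving Measure.quasiMeasurePreserving_fst)
  have hm2 : AEMeasurable (fun p : V × V => κ p.1 p.2 * ‖A p.2‖ₑ ^ 2) (μ.prod μ) :=
    hκ.aemeasurable.mul (hAm.comp_quasiMeasurePreserving Measure.quasiMeasurePreserving_snd)
  have hb1 : ∫⁻ p : V × V, κ p.1 p.2 * ‖A p.1‖ₑ ^ 2 ∂(μ.prod μ) ≤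
      C * ∫⁻ v, ‖A v‖ₑ ^ 2 ∂μ := by
    rw [lintegral_prod _ hm1, ← lintegral_const_mul'' _ hAm]
    refine lintegral_mono fun v => ?_
    simp only
    rw [lintegral_mul_const _ (hκ.of_uncurry_left)]
    gcongr
    exact hC v
  have hb2 : ∫⁻ p : V × V, κ p.1 p.2 * ‖A p.2‖ₑ ^ 2 ∂(μ.prod μ) ≤
      C * ∫⁻ v, ‖A v‖ₑ ^ 2 ∂μ := by
    rw [lintegral_prod_symm _ hm2, ← lintegral_const_mul'' _ hAm]
    refine lintegral_mono fun v => ?_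
    simp only
    rw [lintegral_mul_const _ (hκ.of_uncurry_right)]
    gcongr
    simp_rw [fun x => hsymm x v]
    exact hC v
  rw [lintegral_const_mul' _ _ (by norm_num), lintegral_add_left' hm1]
  calc _ ≤ 2⁻¹ * (C * ∫⁻ v, ‖A v‖ₑ ^ 2 ∂μ + C * ∫⁻ v, ‖A v‖ₑ ^ 2 ∂μ) := by gcongr
    _ = _ := by
      rw [← two_mul, ← mul_assoc, ENNReal.inv_mul_cancel (by norm_num) (by norm_num), one_mul]

/-! ### Gaussian weights -/

section Gauss
variable {V : Type*} [NormedAddCommGroup V] [InnerProductSpace ℝ V] [FiniteDimensional ℝ V]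
  [MeasurableSpace V] [BorelSpace V]

/-- The Gaussian weight `e^{-ε|x|²} dx`. -/
def gaussWeight (V : Type*) [NormedAddCommGroup V] [InnerProductSpace ℝ V] [FiniteDimensional ℝ V]
    [MeasurableSpace V] [BorelSpace V] (ε : ℝ) : Measure V :=
  volume.withDensity fun x => ((Real.exp (-ε * ‖x‖ ^ 2)).toNNReal : ℝ≥0∞)

lemma integrable_gauss {ε : ℝ} (hε : 0 < ε) :
    Integrable (fun x : V => Real.exp (-ε * ‖x‖ ^ 2)) := by
  have h := (GaussianFourier.integrable_cexp_neg_mul_sq_norm_add (V := V) (b := (ε : ℂ))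
    (by simpa using hε) 0 0).re
  refine h.congr (Eventually.of_forall fun x => ?_)
  simp only [zero_mul, add_zero]
  rw [show (-(ε : ℂ) * (‖x‖ : ℂ) ^ 2) = ((-ε * ‖x‖ ^ 2 : ℝ) : ℂ) by push_cast; ring]
  exact Complex.exp_ofReal_re _

lemma lintegral_gauss {ε : ℝ} (hε : 0 < ε) (a : V) :
    ∫⁻ x : V, ENNReal.ofReal (Real.exp (-ε * ‖x - a‖ ^ 2)) =
      ENNReal.ofReal ((Real.pi / ε) ^ (Module.finrank ℝ V / 2 : ℝ)) := by
  rw [lintegral_sub_right_eq_self (fun x : V => ENNReal.ofReal (Real.exp (-ε * ‖x‖ ^ 2))) a,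
    ← GaussianFourier.integral_rexp_neg_mul_sq_norm hε,
    ofReal_integral_eq_lintegral_ofReal (integrable_gauss hε)
      (Eventually.of_forall fun x => by positivity)]

lemma isFiniteMeasure_gaussWeight {ε : ℝ} (hε : 0 < ε) : IsFiniteMeasure (gaussWeight V ε) := by
  refine ⟨?_⟩
  have h := lintegral_gauss (V := V) hε 0
  simp only [sub_zero] at h
  rw [gaussWeight, withDensity_apply _ MeasurableSet.univ, Measure.restrict_univ]
  exact h.trans_lt ENNReal.ofReal_lt_top

/-- The Fourier transform of the Gaussian weight. -/
lemma integral_cexp_inner_gaussWeight {ε : ℝ} (hε : 0 < ε) (w : V) :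
    ∫ x, Complex.exp (Complex.I * ((inner ℝ w x : ℝ) : ℂ)) ∂(gaussWeight V ε) =
      (((Real.pi / ε) ^ (Module.finrank ℝ V / 2 : ℝ) * Real.exp (-‖w‖ ^ 2 / (4 * ε)) : ℝ) : ℂ) := by
  have h := GaussianFourier.integral_cexp_neg_mul_sq_norm_add (V := V) (b := (ε : ℂ))
    (by simpa using hε) Complex.I w
  rw [gaussWeight, integral_withDensity_eq_integral_smul (by fun_prop)]
  refine (integral_congr_ae (Eventually.of_forall fun x => ?_)).trans (h.trans ?_)
  · simp only [NNReal.smul_def, Complex.real_smul]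
    rw [Real.coe_toNNReal _ (Real.exp_nonneg _), Complex.ofReal_exp, ← Complex.exp_add]
    push_cast; ring_nf
  · rw [Complex.I_sq, Complex.ofReal_mul, Complex.ofReal_exp, Complex.ofReal_cpow (by positivity)]
    push_cast; ring_nf

end Gauss

/-- In polar coordinates the variable `ρ = |x|²` has constant density `π` on the half-line, because
the dimension is two; the integral is then one of a Gaussian on `ℝ`, whatever its centre. -/
lemma lintegral_gauss_normSq_le {c : ℝ} (hc : 0 < c) (a : ℝ) :
    ∫⁻ x : Plane, ENNReal.ofReal (Real.exp (-c * (‖x‖ ^ 2 - a) ^ 2)) ≤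
      ENNReal.ofReal (Real.pi * (Real.pi / c) ^ (1 / 2 : ℝ)) := by
  set g : ℝ → ℝ := fun ρ => Real.exp (-c * (ρ - a) ^ 2) with hg
  have hgi : Integrable g := by
    have := (integrable_gauss (V := ℝ) hc).comp_sub_right a
    simpa [hg] using this
  have hgint : ∫ ρ, g ρ = (Real.pi / c) ^ (1 / 2 : ℝ) := by
    have h1 := integral_sub_right_eq_self (fun x : ℝ => Real.exp (-c * ‖x‖ ^ 2)) a (μ := volume)
    rw [GaussianFourier.integral_rexp_neg_mul_sq_norm hc] at h1
    simpa [hg] using h1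
  have hfr : Module.finrank ℝ Plane = 2 := by simp
  have hsub : ∀ y ∈ Set.Ioi (0 : ℝ), (2 * y ^ ((2 : ℝ) - 1)) • g (y ^ (2 : ℝ)) =
      2 * (y * g (y ^ 2)) := by
    intro y hy
    norm_num
    ring
  have hi2 : IntegrableOn (fun y : ℝ => y ^ (Module.finrank ℝ Plane - 1) • g (y ^ 2))
      (Set.Ioi 0) := by
    have h1 := (integrableOn_Ioi_comp_rpow_iff' g (p := 2) (by norm_num)).2 hgi.integrableOn
    rw [hfr]
    refine h1.congr_fun (fun y hy => ?_) measurableSet_Ioi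
    norm_num
  have hi3 : Integrable (fun x : Plane => g (‖x‖ ^ 2)) :=
    (integrable_fun_norm_addHaar (volume : Measure Plane) (f := fun y => g (y ^ 2))).2 hi2
  rw [← ofReal_integral_eq_lintegral_ofReal hi3 (Eventually.of_forall fun x => by positivity)]
  apply ENNReal.ofReal_le_ofReal
  have h4 := integral_fun_norm_addHaar (volume : Measure Plane) (fun y => g (y ^ 2))
  have hvol : (volume : Measure Plane).real (Metric.ball 0 1) = Real.pi := by
    rw [Measure.real, EuclideanSpace.volume_ball_fin_two]
    simp [Real.pi_pos.le]
  have h5 := integral_comp_rpow_Ioi_of_pos (g := g) (p := 2) (by norm_num)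
  rw [setIntegral_congr_fun measurableSet_Ioi hsub, integral_const_mul] at h5
  rw [h4, hvol, hfr, ← hgint]
  simp only [Nat.add_one_sub_one, pow_one, smul_eq_mul, nsmul_eq_mul, Nat.cast_ofNat]
  have h6 : ∫ ρ in Set.Ioi 0, g ρ ≤ ∫ ρ, g ρ :=
    setIntegral_le_integral hgi (Eventually.of_forall fun x => by simp only [hg]; positivity)
  calc _ = Real.pi * (2 * ∫ y in Set.Ioi 0, y * g (y ^ 2)) := by ring
    _ ≤ _ := by rw [h5]; gcongr

/-! ### The Strichartz estimate with a Gaussian weight -/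

/-- The frequency `-2π(ξ₁ + ξ₂)` of the product of two plane waves. -/
def pairFreq (ζ : Plane × Plane) : Plane := (-(2 * Real.pi)) • (ζ.1 + ζ.2)

/-- The temporal frequency `-4π²(|ξ₁|² + |ξ₂|²)` of the product of two free plane waves. -/
def pairEnergy (ζ : Plane × Plane) : ℝ :=
  -((2 * Real.pi * ‖ζ.1‖) ^ 2 + (2 * Real.pi * ‖ζ.2‖) ^ 2)

/-- The Fourier transform of the space-time Gaussian weight, evaluated at the difference of the
space-time frequencies of two pairs of free plane waves. -/
def pairKernel (ε : ℝ) (ζ ζ' : Plane × Plane) : ℝ≥0∞ :=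
  ENNReal.ofReal (Real.pi / ε * Real.exp (-‖pairFreq ζ - pairFreq ζ'‖ ^ 2 / (4 * ε))) *
    ENNReal.ofReal ((Real.pi / ε) ^ (1 / 2 : ℝ) *
      Real.exp (-‖pairEnergy ζ - pairEnergy ζ'‖ ^ 2 / (4 * ε)))

lemma continuous_pairFreq : Continuous pairFreq := by unfold pairFreq; fun_prop

lemma continuous_pairEnergy : Continuous pairEnergy := by unfold pairEnergy; fun_prop

lemma measurable_pairKernel (ε : ℝ) : Measurable (Function.uncurry (pairKernel ε)) := by
  have h1 := continuous_pairFreq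
  have h2 := continuous_pairEnergy
  refine Measurable.mul (f := fun p : (Plane × Plane) × (Plane × Plane) => ENNReal.ofReal _)
    (g := fun p : (Plane × Plane) × (Plane × Plane) => ENNReal.ofReal _) ?_ ?_
  · exact (Continuous.measurable (by fun_prop)).ennreal_ofReal
  · exact (Continuous.measurable (by fun_prop)).ennreal_ofReal

/-- In the coordinates `p = ξ₃ + ξ₄`, `η = (ξ₃ - ξ₄)/2` one has `|ξ₃|² + |ξ₄|² = |p|²/2 + 2|η|²`;
in dimension two `|η|²` is uniformly distributed, so that the integral of the kernel is bounded
by a constant that does not depend on `ε`. -/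
lemma lintegral_pairKernel_le {ε : ℝ} (hε : 0 < ε) (ζ : Plane × Plane) :
    ∫⁻ ζ', pairKernel ε ζ ζ' ≤ 1 := by
  have hpi := Real.pi_pos
  set c : ℝ := 16 * Real.pi ^ 4 / ε with hc
  have hc0 : 0 < c := by positivity
  rw [Measure.volume_eq_prod,
    lintegral_prod _ ((measurable_pairKernel ε).of_uncurry_left).aemeasurable]
  have h1 : ∀ x : Plane, ∫⁻ y, pairKernel ε ζ (x, y) = ∫⁻ p, pairKernel ε ζ (x, p - x) :=
    fun x => (lintegral_sub_right_eq_self (fun y => pairKernel ε ζ (x, y)) x).symm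
  simp_rw [h1]
  rw [lintegral_lintegral_swap]
  swap
  · refine Measurable.aemeasurable ?_
    exact ((measurable_pairKernel ε).of_uncurry_left (x := ζ)).comp (by fun_prop)
  have h2 : ∀ p : Plane, ∫⁻ x, pairKernel ε ζ (x, p - x) ≤
      ENNReal.ofReal (Real.pi / ε * (1 / 4)) *
        ENNReal.ofReal (Real.exp (-(Real.pi ^ 2 / ε) * ‖p - (ζ.1 + ζ.2)‖ ^ 2)) := by
    intro p
    -- the substitution `η = x - p / 2` completes the square in the energy
    set a : ℝ := -pairEnergy ζ / (8 * Real.pi ^ 2) - ‖p‖ ^ 2 / 4 with ha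
    rw [← lintegral_add_right_eq_self _ ((1 / 2 : ℝ) • p)]
    have h3 : ∀ η : Plane, pairKernel ε ζ (η + (1 / 2 : ℝ) • p, p - (η + (1 / 2 : ℝ) • p)) =
        ENNReal.ofReal (Real.pi / ε * Real.exp (-(Real.pi ^ 2 / ε) * ‖p - (ζ.1 + ζ.2)‖ ^ 2)) *
        ENNReal.ofReal ((Real.pi / ε) ^ (1 / 2 : ℝ)) *
          ENNReal.ofReal (Real.exp (-c * (‖η‖ ^ 2 - a) ^ 2)) := by
      intro η
      rw [mul_assoc, ← ENNReal.ofReal_mul (by positivity)]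
      unfold pairKernel
      congr 4
      · have : pairFreq ζ - pairFreq (η + (1 / 2 : ℝ) • p, p - (η + (1 / 2 : ℝ) • p)) =
            (2 * Real.pi) • (p - (ζ.1 + ζ.2)) := by
          unfold pairFreq
          simp only [add_sub_cancel]
          module
        rw [this, norm_smul, Real.norm_of_nonneg (by positivity)]
        field_simp
        ring
      · have h5 : pairEnergy ζ - pairEnergy (η + (1 / 2 : ℝ) • p, p - (η + (1 / 2 : ℝ) • p)) =
            8 * Real.pi ^ 2 * (‖η‖ ^ 2 - a) := by
          have e1 : ‖η + (1 / 2 : ℝ) • p‖ ^ 2 + ‖p - (η + (1 / 2 : ℝ) • p)‖ ^ 2 =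
              2 * (‖η‖ ^ 2 + ‖(1 / 2 : ℝ) • p‖ ^ 2) := by
            have := parallelogram_law_with_norm ℝ ((1 / 2 : ℝ) • p) η
            rw [show p - (η + (1 / 2 : ℝ) • p) = (1 / 2 : ℝ) • p - η by module, add_comm η]
            nlinarith [this]
          have e2 : ‖(1 / 2 : ℝ) • p‖ ^ 2 = ‖p‖ ^ 2 / 4 := by
            rw [norm_smul, mul_pow]; norm_num; ring
          rw [e2] at e1
          have e3 : pairEnergy (η + (1 / 2 : ℝ) • p, p - (η + (1 / 2 : ℝ) • p)) =
              -(4 * Real.pi ^ 2 * (2 * (‖η‖ ^ 2 + ‖p‖ ^ 2 / 4))) := by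
            rw [← e1, pairEnergy]; ring
          rw [e3, ha]
          field_simp
          ring
        rw [h5, Real.norm_eq_abs, sq_abs, hc]
        field_simp
        ring
    simp_rw [h3]
    rw [lintegral_const_mul _ (by fun_prop)]
    refine (mul_le_mul' le_rfl (lintegral_gauss_normSq_le hc0 a)).trans ?_
    rw [← ENNReal.ofReal_mul (by positivity), ← ENNReal.ofReal_mul (by positivity),
      ← ENNReal.ofReal_mul (by positivity)]
    apply ENNReal.ofReal_le_ofReal
    have h6 : (Real.pi / ε) ^ (1 / 2 : ℝ) * (Real.pi / c) ^ (1 / 2 : ℝ) = 1 / (4 * Real.pi) := by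
      rw [← Real.mul_rpow (by positivity) (by positivity), ← Real.sqrt_eq_rpow]
      rw [show Real.pi / ε * (Real.pi / c) = (1 / (4 * Real.pi)) ^ 2 by rw [hc]; field_simp; ring]
      exact Real.sqrt_sq (by positivity)
    apply le_of_eq
    calc _ = Real.pi / ε * Real.exp (-(Real.pi ^ 2 / ε) * ‖p - (ζ.1 + ζ.2)‖ ^ 2) * Real.pi *
          ((Real.pi / ε) ^ (1 / 2 : ℝ) * (Real.pi / c) ^ (1 / 2 : ℝ)) := by ring
      _ = _ := by rw [h6]; field_simp
  refine (lintegral_mono h2).trans ?_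
  rw [lintegral_const_mul _ (by fun_prop), lintegral_gauss (by positivity),
    ← ENNReal.ofReal_mul (by positivity)]
  refine ENNReal.ofReal_le_one.2 ?_
  have : (Module.finrank ℝ Plane : ℝ) / 2 = 1 := by simp
  rw [this, Real.rpow_one]
  have : Real.pi / ε * (1 / 4) * (Real.pi / (Real.pi ^ 2 / ε)) = 1 / 4 := by field_simp
  rw [this]; norm_num

/-- The solution `𝓕(e^{-it|2πξ|²} χ)` of the free Schrödinger equation with initial datum `𝓕 χ`. -/
def freeWave (χ : Plane → ℂ) (t : ℝ) (x : Plane) : ℂ :=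
  ∫ ξ, Complex.exp (Complex.I * ((inner ℝ (-(2 * Real.pi) • ξ) x : ℝ) : ℂ)) *
    Complex.exp (Complex.I * ((inner ℝ (-(2 * Real.pi * ‖ξ‖) ^ 2) t : ℝ) : ℂ)) * χ ξ

lemma norm_cexp_I_mul (r : ℝ) : ‖Complex.exp (Complex.I * (r : ℂ))‖ = 1 := by
  rw [mul_comm]; exact Complex.norm_exp_ofReal_mul_I r

/-- The Strichartz estimate with a Gaussian weight in space-time. The square of the wave is an
oscillatory integral over pairs of frequencies, to which Schur's test applies. -/
lemma lintegral_freeWave_gauss_le {χ : Plane → ℂ} (hχ : Integrable χ) {ε : ℝ} (hε : 0 < ε) :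
    ∫⁻ z, ‖freeWave χ z.1 z.2‖ₑ ^ 4 ∂((gaussWeight ℝ ε).prod (gaussWeight Plane ε)) ≤
      (∫⁻ ξ, ‖χ ξ‖ₑ ^ 2) ^ 2 := by
  have := isFiniteMeasure_gaussWeight (V := ℝ) hε
  have := isFiniteMeasure_gaussWeight (V := Plane) hε
  set e : ℝ × Plane → Plane × Plane → ℂ := fun z ζ =>
    Complex.exp (Complex.I * ((inner ℝ (pairFreq ζ) z.2 : ℝ) : ℂ)) *
      Complex.exp (Complex.I * ((inner ℝ (pairEnergy ζ) z.1 : ℝ) : ℂ)) with he_def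
  have he : Measurable (Function.uncurry e) := by
    have h1 := continuous_pairFreq
    have h2 := continuous_pairEnergy
    refine Continuous.measurable ?_
    unfold Function.uncurry
    simp only [he_def]
    fun_prop
  have hsq : ∀ z, ‖freeWave χ z.1 z.2‖ₑ ^ 4 =
      ‖∫ ζ : Plane × Plane, e z ζ * (χ ζ.1 * χ ζ.2)‖ₑ ^ 2 := by
    intro z
    rw [show 4 = 2 * 2 by norm_num, pow_mul, ← enorm_pow, sq (freeWave χ z.1 z.2)]
    congr 2
    rw [freeWave, ← integral_prod_mul, Measure.volume_eq_prod]
    congr 1; ext ζ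
    simp only [he_def]
    rw [show inner ℝ (pairFreq ζ) z.2 = inner ℝ (-(2 * Real.pi) • ζ.1) z.2 +
        inner ℝ (-(2 * Real.pi) • ζ.2) z.2 by rw [← inner_add_left, ← smul_add]; rfl,
      show inner ℝ (pairEnergy ζ) z.1 = inner ℝ (-(2 * Real.pi * ‖ζ.1‖) ^ 2) z.1 +
        inner ℝ (-(2 * Real.pi * ‖ζ.2‖) ^ 2) z.1 by
          rw [← inner_add_left]; congr 1; unfold pairEnergy; ring]
    push_cast
    rw [mul_add, mul_add, Complex.exp_add, Complex.exp_add]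
    ring
  simp_rw [hsq]
  have hk : ∀ ζ ζ', ‖∫ z, e z ζ * starRingEnd ℂ (e z ζ')
      ∂((gaussWeight ℝ ε).prod (gaussWeight Plane ε))‖ₑ ≤ pairKernel ε ζ ζ' := by
    intro ζ ζ'
    have h1 : ∀ z : ℝ × Plane, e z ζ * starRingEnd ℂ (e z ζ') =
        Complex.exp (Complex.I * ((inner ℝ (pairEnergy ζ - pairEnergy ζ') z.1 : ℝ) : ℂ)) *
        Complex.exp (Complex.I * ((inner ℝ (pairFreq ζ - pairFreq ζ') z.2 : ℝ) : ℂ)) := by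
      intro z
      simp only [he_def, map_mul, ← Complex.exp_conj, Complex.conj_I, Complex.conj_ofReal]
      simp only [← Complex.exp_add, inner_sub_left]
      congr 1
      push_cast
      ring
    simp_rw [h1]
    rw [integral_prod_mul (fun t : ℝ =>
        Complex.exp (Complex.I * ((inner ℝ (pairEnergy ζ - pairEnergy ζ') t : ℝ) : ℂ)))
        (fun x : Plane => Complex.exp (Complex.I * ((inner ℝ (pairFreq ζ - pairFreq ζ') x : ℝ) : ℂ))),
      integral_cexp_inner_gaussWeight hε, integral_cexp_inner_gaussWeight hε, enorm_mul, pairKernel,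
      mul_comm]
    have hf : (Module.finrank ℝ Plane : ℝ) / 2 = 1 := by simp
    have hf1 : (Module.finrank ℝ ℝ : ℝ) / 2 = 1 / 2 := by simp
    rw [hf, hf1, Real.rpow_one]
    refine le_of_eq ?_
    congr 1
    · rw [← ofReal_norm, Complex.norm_real, Real.norm_of_nonneg (by positivity)]
    · rw [← ofReal_norm, Complex.norm_real, Real.norm_of_nonneg (by positivity)]
  refine (lintegral_enorm_integral_sq_le_of_schur _ volume he (fun z ζ => ?_)
    (A := fun ζ : Plane × Plane => χ ζ.1 * χ ζ.2)
    (hχ.mul_prod hχ) (measurable_pairKernel ε) (fun v w => ?_) hk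
    (lintegral_pairKernel_le hε)).trans ?_
  · simp only [he_def]
    rw [norm_mul, norm_cexp_I_mul, norm_cexp_I_mul, one_mul]
  · unfold pairKernel
    rw [norm_sub_rev, norm_sub_rev (pairEnergy v)]
  · rw [one_mul, Measure.volume_eq_prod, sq (∫⁻ ξ, ‖χ ξ‖ₑ ^ 2),
      ← lintegral_prod_mul (hχ.1.enorm.pow_const 2) (hχ.1.enorm.pow_const 2)]
    refine le_of_eq (lintegral_congr fun ζ => ?_)
    rw [enorm_mul, mul_pow]

/-! ### The Strichartz estimate for Fourier data -/

lemma measurable_freeWave {χ : Plane → ℂ} (hχ : StronglyMeasurable χ) :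
    Measurable (Function.uncurry (freeWave χ)) := by
  refine StronglyMeasurable.measurable ?_
  have h : StronglyMeasurable (fun q : (ℝ × Plane) × Plane =>
      Complex.exp (Complex.I * ((inner ℝ (-(2 * Real.pi) • q.2) q.1.2 : ℝ) : ℂ)) *
      Complex.exp (Complex.I * ((inner ℝ (-(2 * Real.pi * ‖q.2‖) ^ 2) q.1.1 : ℝ) : ℂ)) * χ q.2) := by
    refine StronglyMeasurable.mul ?_ (hχ.comp_measurable measurable_snd)
    refine Continuous.stronglyMeasurable ?_
    fun_prop
  exact h.integral_prod_right

/-- The `L⁴` Strichartz estimate in dimension two, in terms of Fourier data. -/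
theorem lintegral_freeWave_le {χ : Plane → ℂ} (hm : StronglyMeasurable χ) (hχ : Integrable χ) :
    ∫⁻ t, ∫⁻ x, ‖freeWave χ t x‖ₑ ^ 4 ≤ (∫⁻ ξ, ‖χ ξ‖ₑ ^ 2) ^ 2 := by
  have hmeas : Measurable fun z : ℝ × Plane => ‖freeWave χ z.1 z.2‖ₑ ^ 4 :=
    (measurable_freeWave hm).enorm.pow_const 4
  set ε : ℕ → ℝ := fun n => 1 / ((n : ℝ) + 1) with hε
  have hε0 : ∀ n, 0 < ε n := fun n => by positivity
  have hεlim : Tendsto ε atTop (𝓝 0) := tendsto_one_div_add_atTop_nhds_zero_nat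
  set w : ℕ → ℝ × Plane → ℝ≥0∞ := fun n z =>
    ((Real.exp (-ε n * ‖z.1‖ ^ 2)).toNNReal : ℝ≥0∞) *
      ((Real.exp (-ε n * ‖z.2‖ ^ 2)).toNNReal : ℝ≥0∞) with hw
  have hwm : ∀ n, Measurable (w n) := by
    intro n; simp only [hw]; fun_prop
  have hb : ∀ n, ∫⁻ z : ℝ × Plane, w n z * ‖freeWave χ z.1 z.2‖ₑ ^ 4 ≤
      (∫⁻ ξ, ‖χ ξ‖ₑ ^ 2) ^ 2 := by
    intro n
    refine le_trans (le_of_eq ?_) (lintegral_freeWave_gauss_le hχ (hε0 n))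
    have := isFiniteMeasure_gaussWeight (V := ℝ) (hε0 n)
    have := isFiniteMeasure_gaussWeight (V := Plane) (hε0 n)
    have hp : (gaussWeight ℝ (ε n)).prod (gaussWeight Plane (ε n)) =
        (volume : Measure (ℝ × Plane)).withDensity (w n) := by
      rw [gaussWeight, gaussWeight] at *
      rw [Measure.volume_eq_prod, prod_withDensity (by fun_prop) (by fun_prop)]
    rw [hp, lintegral_withDensity_eq_lintegral_mul _ (hwm n) hmeas]
    rfl
  have hlim : ∀ z : ℝ × Plane, Tendsto (fun n => w n z * ‖freeWave χ z.1 z.2‖ₑ ^ 4) atTop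
      (𝓝 (‖freeWave χ z.1 z.2‖ₑ ^ 4)) := by
    intro z
    have h1 : ∀ r : ℝ, Tendsto (fun n => ((Real.exp (-ε n * r)).toNNReal : ℝ≥0∞)) atTop (𝓝 1) := by
      intro r
      have : Tendsto (fun n => Real.exp (-ε n * r)) atTop (𝓝 1) := by
        have h2 : Tendsto (fun n => -ε n * r) atTop (𝓝 0) := by
          simpa using hεlim.neg.mul_const r
        simpa [Function.comp_def] using (Real.continuous_exp.tendsto 0).comp h2
      have h3 := ENNReal.tendsto_ofReal this
      simpa [ENNReal.ofReal] using h3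
    have h4 : Tendsto (fun n => w n z) atTop (𝓝 1) := by
      have := ENNReal.Tendsto.mul (h1 (‖z.1‖ ^ 2)) (by simp) (h1 (‖z.2‖ ^ 2)) (by simp)
      simpa [hw] using this
    have := ENNReal.Tendsto.mul_const (b := ‖freeWave χ z.1 z.2‖ₑ ^ 4) h4 (by simp)
    simpa using this
  rw [← lintegral_prod _ hmeas.aemeasurable, ← Measure.volume_eq_prod]
  calc ∫⁻ z : ℝ × Plane, ‖freeWave χ z.1 z.2‖ₑ ^ 4
      = ∫⁻ z : ℝ × Plane, liminf (fun n => w n z * ‖freeWave χ z.1 z.2‖ₑ ^ 4) atTop :=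
        lintegral_congr fun z => (hlim z).liminf_eq.symm
    _ ≤ liminf (fun n => ∫⁻ z : ℝ × Plane, w n z * ‖freeWave χ z.1 z.2‖ₑ ^ 4) atTop :=
        lintegral_liminf_le fun n => (hwm n).mul hmeas
    _ ≤ _ := by
        refine liminf_le_of_le (by isBoundedDefault) (fun b hb' => ?_)
        obtain ⟨n, hn⟩ := hb'.exists
        exact hn.trans (hb n)

lemma hasTemperateGrowth_cexp_mul_I :
    (fun θ : ℝ => Complex.exp ((θ : ℂ) * Complex.I)).HasTemperateGrowth := by
  have hd : ∀ n : ℕ, iteratedDeriv n (fun θ : ℝ => Complex.exp ((θ : ℂ) * Complex.I)) =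
      fun θ : ℝ => Complex.I ^ n * Complex.exp ((θ : ℂ) * Complex.I) := by
    intro n
    induction n with
    | zero => simp
    | succ n ih =>
      rw [iteratedDeriv_succ, ih]
      ext θ
      have h1 : HasDerivAt (fun θ : ℝ => (θ : ℂ) * Complex.I) Complex.I θ := by
        simpa using (Complex.ofRealCLM.hasDerivAt (x := θ)).mul_const Complex.I
      rw [(h1.cexp.const_mul (Complex.I ^ n)).deriv]
      ring
  refine ⟨?_, fun n => ⟨0, 1, fun θ => ?_⟩⟩
  · have : ContDiff ℝ ⊤ fun θ : ℝ => (θ : ℂ) * Complex.I :=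
      Complex.ofRealCLM.contDiff.mul contDiff_const
    exact (this.cexp).of_le (by simp)
  · rw [norm_iteratedFDeriv_eq_norm_iteratedDeriv, hd]
    simp [Complex.norm_exp_ofReal_mul_I]

lemma hasTemperateGrowth_schrodingerSymbol (t : ℝ) :
    (schrodingerSymbol t).HasTemperateGrowth := by
  have h : (fun ξ : Plane => -(t * (2 * Real.pi * ‖ξ‖) ^ 2)).HasTemperateGrowth := by
    have : (fun ξ : Plane => -(t * (2 * Real.pi * ‖ξ‖) ^ 2)) =
        fun ξ : Plane => (-(t * (2 * Real.pi) ^ 2)) * ‖ξ‖ ^ 2 := by ext; ring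
    rw [this]
    fun_prop
  exact hasTemperateGrowth_cexp_mul_I.comp h

/-- Multiplication of a Schwartz function by the symbol of the free propagator. -/
def symbolMul (t : ℝ) (χ : 𝓢(Plane, ℂ)) : 𝓢(Plane, ℂ) :=
  SchwartzMap.smulLeftCLM ℂ (schrodingerSymbol t) χ

lemma symbolMul_apply (t : ℝ) (χ : 𝓢(Plane, ℂ)) (ξ : Plane) :
    symbolMul t χ ξ = schrodingerSymbol t ξ * χ ξ :=
  SchwartzMap.smulLeftCLM_apply_apply (hasTemperateGrowth_schrodingerSymbol t) χ ξ

lemma fourier_symbolMul_apply (t : ℝ) (χ : 𝓢(Plane, ℂ)) (x : Plane) :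
    𝓕 (symbolMul t χ) x = freeWave χ t x := by
  rw [SchwartzMap.fourier_coe, Real.fourier_eq', freeWave]
  congr 1; ext ξ
  rw [symbolMul_apply, smul_eq_mul, ← mul_assoc, schrodingerSymbol]
  congr 2
  · congr 1
    rw [inner_smul_left]
    simp only [conj_trivial]
    push_cast; ring
  · congr 1
    simp
    ring

/-! ### The free propagator and the homogeneous Strichartz estimate -/

lemma fourier_freeProp (t : ℝ) (f : L2) :
    (𝓕 (freeProp t f) : L2) = (memLp_schrodingerSymbol_mul t (𝓕 f)).toLp _ :=
  FourierTransform.fourier_fourierInv_eq _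

lemma fourier_freeProp_ae (t : ℝ) (f : L2) :
    (𝓕 (freeProp t f) : L2) =ᵐ[volume] fun ξ => schrodingerSymbol t ξ * (𝓕 f : L2) ξ := by
  rw [fourier_freeProp]
  exact MemLp.coeFn_toLp _

lemma fourier_injective : Function.Injective (fun f : L2 => (𝓕 f : L2)) :=
  (Lp.fourierTransformₗᵢ Plane ℂ).injective

lemma fourier_sub' (f g : L2) : (𝓕 (f - g) : L2) = 𝓕 f - 𝓕 g :=
  (Lp.fourierTransformₗᵢ Plane ℂ).map_sub f g

lemma schrodingerSymbol_add (s t : ℝ) (ξ : Plane) :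
    schrodingerSymbol (s + t) ξ = schrodingerSymbol s ξ * schrodingerSymbol t ξ := by
  unfold schrodingerSymbol
  rw [← Complex.exp_add]
  push_cast; ring_nf

lemma freeProp_freeProp (s t : ℝ) (f : L2) : freeProp s (freeProp t f) = freeProp (s + t) f := by
  apply fourier_injective
  apply Lp.ext
  filter_upwards [fourier_freeProp_ae s (freeProp t f), fourier_freeProp_ae t f,
    fourier_freeProp_ae (s + t) f] with ξ h1 h2 h3
  rw [h1, h2, h3, schrodingerSymbol_add, mul_assoc]

lemma freeProp_zero (f : L2) : freeProp 0 f = f := by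
  apply fourier_injective
  apply Lp.ext
  filter_upwards [fourier_freeProp_ae 0 f] with ξ h1
  rw [h1]
  simp [schrodingerSymbol]

lemma freeProp_sub (t : ℝ) (f g : L2) : freeProp t (f - g) = freeProp t f - freeProp t g := by
  apply fourier_injective
  apply Lp.ext
  simp only [fourier_sub']
  filter_upwards [fourier_freeProp_ae t (f - g), fourier_freeProp_ae t f, fourier_freeProp_ae t g,
    Lp.coeFn_sub (𝓕 (freeProp t f) : L2) (𝓕 (freeProp t g)),
    Lp.coeFn_sub (𝓕 f : L2) (𝓕 g)] with ξ h1 h2 h3 h4 h5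
  rw [fourier_sub'] at h1
  rw [h1, h4, Pi.sub_apply, h2, h3, h5, Pi.sub_apply, mul_sub]

lemma norm_freeProp (t : ℝ) (f : L2) : ‖freeProp t f‖ = ‖f‖ := by
  rw [← Lp.norm_fourier_eq (freeProp t f), ← Lp.norm_fourier_eq f, Lp.norm_def, Lp.norm_def]
  congr 1
  refine eLpNorm_congr_norm_ae ?_
  filter_upwards [fourier_freeProp_ae t f] with ξ h1
  rw [h1, norm_mul, norm_schrodingerSymbol, one_mul]

lemma isometry_freeProp (t : ℝ) : Isometry (freeProp t) := by
  refine Isometry.of_dist_eq fun f g => ?_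
  rw [dist_eq_norm, dist_eq_norm, ← freeProp_sub, norm_freeProp]

lemma freeProp_toLp (t : ℝ) (g : 𝓢(Plane, ℂ)) :
    freeProp t (g.toLp 2) = (𝓕⁻ (symbolMul t (𝓕 g))).toLp 2 := by
  rw [← SchwartzMap.toLp_fourierInv_eq, freeProp]
  congr 1
  apply Lp.ext
  refine (MemLp.coeFn_toLp _).trans ?_
  rw [SchwartzMap.toLp_fourier_eq]
  filter_upwards [(𝓕 g).coeFn_toLp 2, (symbolMul t (𝓕 g)).coeFn_toLp 2] with ξ h1 h2
  rw [h1, h2, symbolMul_apply]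

lemma norm_schrodingerSymbol_sub_le (s t : ℝ) (ξ : Plane) :
    ‖schrodingerSymbol s ξ - schrodingerSymbol t ξ‖ ≤ 2 :=
  (norm_sub_le _ _).trans (by rw [norm_schrodingerSymbol, norm_schrodingerSymbol]; norm_num)

lemma continuous_freeProp (f : L2) : Continuous fun t => freeProp t f := by
  rw [continuous_iff_continuousAt]
  intro t
  rw [ContinuousAt, tendsto_iff_norm_sub_tendsto_zero]
  have h : ∀ s, ‖freeProp s f - freeProp t f‖ =
      (∫⁻ ξ, ‖(schrodingerSymbol s ξ - schrodingerSymbol t ξ) * (𝓕 f : L2) ξ‖ₑ ^ 2).toReal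
        ^ (1 / 2 : ℝ) := by
    intro s
    rw [← Lp.norm_fourier_eq, fourier_sub', Lp.norm_def,
      eLpNorm_congr_ae (g := fun ξ => (schrodingerSymbol s ξ - schrodingerSymbol t ξ) * (𝓕 f : L2) ξ)]
    · rw [eLpNorm_eq_lintegral_rpow_enorm_toReal (by norm_num) (by norm_num), ENNReal.toReal_rpow]
      simp
    · filter_upwards [fourier_freeProp_ae s f, fourier_freeProp_ae t f,
        Lp.coeFn_sub (𝓕 (freeProp s f) : L2) (𝓕 (freeProp t f))] with ξ h2 h3 h4
      rw [h4, Pi.sub_apply, h2, h3, sub_mul]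
  simp_rw [h]
  have hfin : ∫⁻ ξ, ‖(𝓕 f : L2) ξ‖ₑ ^ 2 ≠ ∞ := by
    have := (Lp.memLp (𝓕 f : L2)).2
    rw [eLpNorm_lt_top_iff_lintegral_rpow_enorm_lt_top (by norm_num) (by norm_num)] at this
    simpa using this.ne
  have hlim : Tendsto (fun s => ∫⁻ ξ, ‖(schrodingerSymbol s ξ - schrodingerSymbol t ξ) *
      (𝓕 f : L2) ξ‖ₑ ^ 2) (𝓝 t) (𝓝 (∫⁻ _ : Plane, 0)) := by
    refine tendsto_lintegral_filter_of_dominated_convergence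
      (fun ξ => 4 * ‖(𝓕 f : L2) ξ‖ₑ ^ 2) ?_ ?_ ?_ ?_
    · refine Eventually.of_forall fun s => ?_
      exact (((continuous_schrodingerSymbol s).sub
        (continuous_schrodingerSymbol t)).measurable.mul (Lp.stronglyMeasurable _).measurable).enorm.pow_const 2
    · refine Eventually.of_forall fun s => Eventually.of_forall fun ξ => ?_
      rw [enorm_mul, mul_pow]
      gcongr
      rw [show (4 : ℝ≥0∞) = 2 ^ 2 by norm_num]
      gcongr
      rw [← ofReal_norm, show (2 : ℝ≥0∞) = ENNReal.ofReal 2 by simp]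
      exact ENNReal.ofReal_le_ofReal (norm_schrodingerSymbol_sub_le s t ξ)
    · rw [lintegral_const_mul' _ _ (by norm_num)]
      exact ENNReal.mul_ne_top (by norm_num) hfin
    · refine Eventually.of_forall fun ξ => ?_
      have hc : Continuous fun s => ‖(schrodingerSymbol s ξ - schrodingerSymbol t ξ) *
          (𝓕 f : L2) ξ‖ₑ ^ 2 := by
        unfold schrodingerSymbol
        fun_prop
      have := hc.tendsto t
      simpa using this
  rw [lintegral_zero] at hlim
  have h1 := ((ENNReal.continuousAt_toReal ENNReal.zero_ne_top).tendsto.comp hlim)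
  have h2 := h1.rpow_const (p := (1 / 2 : ℝ)) (Or.inr (by norm_num))
  simpa [Function.comp_def] using h2

/-- The `Lʳ` norm is lower semicontinuous on `L²`. -/
lemma lowerSemicontinuous_eLpNorm (r : ℝ≥0∞) :
    LowerSemicontinuous fun f : L2 => eLpNorm f r volume := by
  rw [lowerSemicontinuous_iff_isClosed_preimage]
  intro c
  refine isSeqClosed_iff_isClosed.1 ?_
  intro f g hf hfg
  obtain ⟨ns, -, hns⟩ := (tendstoInMeasure_of_tendsto_Lp hfg).exists_seq_tendsto_ae
  exact Lp.eLpNorm_le_of_ae_tendsto (u := atTop) (f := fun n => (f (ns n) : Plane → ℂ))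
    (Eventually.of_forall fun n => hf (ns n)) (fun n => Lp.aestronglyMeasurable _) hns

lemma measurable_eLpNorm_freeProp (r : ℝ≥0∞) (f : L2) :
    Measurable fun t => eLpNorm (freeProp t f) r volume :=
  ((lowerSemicontinuous_eLpNorm r).comp (continuous_freeProp f)).measurable

lemma eLpNorm_pow_nat {α E : Type*} [MeasurableSpace α] [TopologicalSpace E] [ContinuousENorm E]
    (μ : Measure α) (f : α → E) (n : ℕ) (hn : n ≠ 0) :
    eLpNorm f n μ ^ n = ∫⁻ x, ‖f x‖ₑ ^ n ∂μ := by
  rw [eLpNorm_eq_lintegral_rpow_enorm_toReal (by exact_mod_cast hn) (by simp),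
    ← ENNReal.rpow_natCast, ← ENNReal.rpow_mul]
  simp [hn]

lemma eLpNorm_four_pow {α E : Type*} [MeasurableSpace α] [TopologicalSpace E] [ContinuousENorm E]
    (μ : Measure α) (f : α → E) : eLpNorm f 4 μ ^ 4 = ∫⁻ x, ‖f x‖ₑ ^ 4 ∂μ := by
  exact_mod_cast eLpNorm_pow_nat μ f 4 (by norm_num)

lemma eLpNorm_two_sq {α E : Type*} [MeasurableSpace α] [TopologicalSpace E] [ContinuousENorm E]
    (μ : Measure α) (f : α → E) : eLpNorm f 2 μ ^ 2 = ∫⁻ x, ‖f x‖ₑ ^ 2 ∂μ := by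
  exact_mod_cast eLpNorm_pow_nat μ f 2 (by norm_num)

lemma eLpNorm_eight_pow {α E : Type*} [MeasurableSpace α] [TopologicalSpace E] [ContinuousENorm E]
    (μ : Measure α) (f : α → E) : eLpNorm f 8 μ ^ 8 = ∫⁻ x, ‖f x‖ₑ ^ 8 ∂μ := by
  exact_mod_cast eLpNorm_pow_nat μ f 8 (by norm_num)

lemma lintegral_eLpNorm_fourier_symbolMul_le (χ : 𝓢(Plane, ℂ)) :
    ∫⁻ t, eLpNorm (𝓕 (symbolMul t χ) : 𝓢(Plane, ℂ)) 4 volume ^ 4 ≤ ‖χ.toLp 2‖ₑ ^ 4 := by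
  have h := lintegral_freeWave_le χ.continuous.stronglyMeasurable χ.integrable
  rw [← eLpNorm_two_sq, ← pow_mul] at h
  simp_rw [eLpNorm_four_pow, fourier_symbolMul_apply]
  rwa [Lp.enorm_def, eLpNorm_congr_ae (χ.coeFn_toLp 2 volume)]

/-- The homogeneous `L⁴` Strichartz estimate for `L²` data. -/
theorem lintegral_eLpNorm_freeProp_le (g : L2) :
    ∫⁻ t, eLpNorm (freeProp t g) 4 volume ^ 4 ≤ ‖g‖ₑ ^ 4 := by
  refine DenseRange.induction_on (p := fun g : L2 =>
    ∫⁻ t, eLpNorm (freeProp t g) 4 volume ^ 4 ≤ ‖g‖ₑ ^ 4)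
    (SchwartzMap.denseRange_toLpCLM (E := Plane) (F := ℂ) (p := 2) ENNReal.ofNat_ne_top) g ?_ ?_
  · refine isSeqClosed_iff_isClosed.1 ?_
    intro f g hf hfg
    simp only [Set.mem_ofPred_eq] at hf ⊢
    have hpt : ∀ t, eLpNorm (freeProp t g) 4 volume ^ 4 ≤
        liminf (fun n => eLpNorm (freeProp t (f n)) 4 volume ^ 4) atTop := by
      intro t
      have h1 : LowerSemicontinuous fun f : L2 => eLpNorm f 4 volume ^ 4 :=
        (ENNReal.continuous_pow 4).comp_lowerSemicontinuous (lowerSemicontinuous_eLpNorm 4)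
          (fun a b hab => pow_le_pow_left' hab 4)
      have h2 : Tendsto (fun n => freeProp t (f n)) atTop (𝓝 (freeProp t g)) :=
        ((isometry_freeProp t).continuous.tendsto g).comp hfg
      exact (lowerSemicontinuousAt_iff_le_liminf.1 (h1 _)).trans (liminf_le_liminf_of_le h2)
    calc _ ≤ ∫⁻ t, liminf (fun n => eLpNorm (freeProp t (f n)) 4 volume ^ 4) atTop :=
          lintegral_mono hpt
      _ ≤ liminf (fun n => ∫⁻ t, eLpNorm (freeProp t (f n)) 4 volume ^ 4) atTop :=
          lintegral_liminf_le fun n => (measurable_eLpNorm_freeProp 4 (f n)).pow_const 4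
      _ ≤ liminf (fun n => ‖f n‖ₑ ^ 4) atTop :=
          liminf_le_liminf (Eventually.of_forall hf)
      _ = _ := by
          refine Tendsto.liminf_eq ?_
          exact ((ENNReal.continuous_pow 4).comp continuous_enorm).continuousAt.tendsto.comp hfg
  · intro χ
    rw [SchwartzMap.toLpCLM_apply]
    have h := lintegral_eLpNorm_fourier_symbolMul_le (𝓕 χ)
    rw [← SchwartzMap.toLp_fourier_eq] at h
    have h2 : ‖(𝓕 (χ.toLp 2) : L2)‖ₑ = ‖χ.toLp (E := Plane) 2‖ₑ := by
      rw [← ofReal_norm, Lp.norm_fourier_eq, ofReal_norm]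
    rw [h2] at h
    refine le_trans (le_of_eq ?_) h
    congr 1; ext t
    congr 1
    rw [freeProp_toLp, eLpNorm_congr_ae (SchwartzMap.coeFn_toLp _ 2 volume)]
    have : ⇑(𝓕⁻ (symbolMul t (𝓕 χ)) : 𝓢(Plane, ℂ)) = ⇑(𝓕 (symbolMul t (𝓕 χ)) : 𝓢(Plane, ℂ)) ∘ Neg.neg := by
      ext x
      rw [SchwartzMap.fourierInv_apply_eq]; rfl
    rw [this]
    exact eLpNorm_comp_measurePreserving (SchwartzMap.continuous _).aestronglyMeasurable
      (Measure.measurePreserving_neg volume)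

/-! ### The Strichartz estimate along a path of data -/

/-- The index of the dyadic cell of generation `n` that contains `ω t`, where `ω` takes its
values in `[0, Ω]`. -/
def dyadicCell (ω : ℝ → ℝ) (Ω : ℝ) (n : ℕ) (t : ℝ) : ℕ := ⌊2 ^ n * ω t / Ω⌋₊

lemma dyadicCell_succ_div_two (ω : ℝ → ℝ) (Ω : ℝ) (n : ℕ) (t : ℝ) :
    dyadicCell ω Ω (n + 1) t / 2 = dyadicCell ω Ω n t := by
  unfold dyadicCell
  rw [← Nat.floor_div_ofNat]
  congr 1
  rw [pow_succ]
  ring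

lemma dyadicCell_le {ω : ℝ → ℝ} {Ω : ℝ} {t : ℝ} (h0 : 0 ≤ ω t) (hΩ : ω t ≤ Ω) (n : ℕ) :
    dyadicCell ω Ω n t ≤ 2 ^ n := by
  unfold dyadicCell
  refine Nat.floor_le_of_le ?_
  push_cast
  rw [mul_div_assoc]
  exact mul_le_of_le_one_right (by positivity) (div_le_one_of_le₀ hΩ (h0.trans hΩ))

lemma abs_sub_le_of_dyadicCell_eq {ω : ℝ → ℝ} {Ω : ℝ} {s t : ℝ} (hs0 : 0 ≤ ω s) (hs : ω s ≤ Ω)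
    (ht0 : 0 ≤ ω t) (ht : ω t ≤ Ω) {n : ℕ} (h : dyadicCell ω Ω n s = dyadicCell ω Ω n t) :
    |ω t - ω s| ≤ Ω / 2 ^ n := by
  rcases (hs0.trans hs).eq_or_lt with h0 | h0
  · subst h0
    rw [le_antisymm hs hs0, le_antisymm ht ht0]
    simp
  · unfold dyadicCell at h
    have a1 := Nat.floor_le (a := 2 ^ n * ω s / Ω) (by positivity)
    have a2 := Nat.lt_floor_add_one (2 ^ n * ω s / Ω)
    have b1 := Nat.floor_le (a := 2 ^ n * ω t / Ω) (by positivity)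
    have b2 := Nat.lt_floor_add_one (2 ^ n * ω t / Ω)
    rw [h] at a1 a2
    have key : |2 ^ n * ω t / Ω - 2 ^ n * ω s / Ω| ≤ 1 := by
      rw [abs_le]; constructor <;> linarith
    have e : 2 ^ n * ω t / Ω - 2 ^ n * ω s / Ω = (ω t - ω s) / (Ω / 2 ^ n) := by
      field_simp
    rw [e, abs_div, abs_of_pos (by positivity : 0 < Ω / 2 ^ n)] at key
    rwa [div_le_one (by positivity)] at key

/-- A path in `L²` whose increments are controlled by the `3/4`-th power of the increments of a
bounded function satisfies the Strichartz estimate. The path is approximated by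
step functions that are constant on the dyadic cells of the control `ω`: the difference of two
consecutive approximations takes at most `2ⁿ⁺¹ + 1` values of size `(Ω/2ⁿ)^{3/4}`, and the
homogeneous estimate, summed over the values, gives a geometric series because `3/4 > 1/4`. -/
theorem lintegral_eLpNorm_freeProp_path_le {J : Set ℝ} {f : ℝ → L2} {ω : ℝ → ℝ} {Ω : ℝ} {t₀ : ℝ}
    (ht₀ : t₀ ∈ J) (hω0 : ∀ t ∈ J, 0 ≤ ω t) (hω : ∀ t ∈ J, ω t ≤ Ω)
    (hf : ∀ s ∈ J, ∀ t ∈ J, ‖f t - f s‖ ≤ |ω t - ω s| ^ (3 / 4 : ℝ)) (hJ : MeasurableSet J) :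
    ∫⁻ t in J, eLpNorm (freeProp t (f t)) 4 volume ^ 4 ≤
      ENNReal.ofReal (2 * ‖f t₀‖ + 10 * Ω ^ (3 / 4 : ℝ)) ^ 4 := by
  classical
  have hΩ0 : 0 ≤ Ω := (hω0 t₀ ht₀).trans (hω t₀ ht₀)
  set W : ℝ := Ω ^ (3 / 4 : ℝ) with hW
  have hW0 : 0 ≤ W := by positivity
  have hpow : ∀ x : ℝ, 0 ≤ x → (x ^ (3 / 4 : ℝ)) ^ 4 = x ^ 3 := by
    intro x hx
    rw [← Real.rpow_natCast, ← Real.rpow_mul hx]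
    norm_num
  have hW4 : W ^ 4 = Ω ^ 3 := hpow Ω hΩ0
  -- a representative of each cell
  have hrep : ∀ n j : ℕ, ∃ s ∈ J, (∃ t ∈ J, dyadicCell ω Ω n t = j) → dyadicCell ω Ω n s = j := by
    intro n j
    by_cases h : ∃ t ∈ J, dyadicCell ω Ω n t = j
    · obtain ⟨t, ht, htj⟩ := h
      exact ⟨t, ht, fun _ => htj⟩
    · exact ⟨t₀, ht₀, fun h' => absurd h' h⟩
  choose s hsJ hs using hrep
  have hs' : ∀ n, ∀ t ∈ J, dyadicCell ω Ω n (s n (dyadicCell ω Ω n t)) = dyadicCell ω Ω n t :=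
    fun n t ht => hs n _ ⟨t, ht, rfl⟩
  -- the step function of generation `n` and its values
  set F : ℕ → ℕ → L2 := fun n j => f (s n j) with hF
  set g : ℕ → ℝ → L2 := fun n t => F n (dyadicCell ω Ω n t) with hg
  have hclose : ∀ n, ∀ t ∈ J, ∀ r ∈ J, dyadicCell ω Ω n t = dyadicCell ω Ω n r →
      ‖f t - f r‖ ≤ (Ω / 2 ^ n) ^ (3 / 4 : ℝ) := by
    intro n t ht r hr h
    refine (hf r hr t ht).trans ?_
    exact Real.rpow_le_rpow (abs_nonneg _) (abs_sub_le_of_dyadicCell_eq (hω0 r hr) (hω r hr)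
      (hω0 t ht) (hω t ht) h.symm) (by norm_num)
  -- the values of the difference between two consecutive step functions
  set d : ℕ → ℕ → L2 := fun n j =>
    if ∃ t ∈ J, dyadicCell ω Ω (n + 1) t = j then F (n + 1) j - F n (j / 2) else 0 with hd
  have hd_le : ∀ n j, ‖d n j‖ ≤ (Ω / 2 ^ n) ^ (3 / 4 : ℝ) := by
    intro n j
    by_cases h : ∃ t ∈ J, dyadicCell ω Ω (n + 1) t = j
    · simp only [hd, if_pos h, hF]
      refine hclose n _ (hsJ _ _) _ (hsJ _ _) ?_
      have h1 := hs (n + 1) j h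
      obtain ⟨t, ht, htj⟩ := h
      have h2 : dyadicCell ω Ω n t = j / 2 := by rw [← dyadicCell_succ_div_two, htj]
      rw [hs n (j / 2) ⟨t, ht, h2⟩, ← dyadicCell_succ_div_two, h1]
    · simp only [hd, if_neg h, norm_zero]
      positivity
  have hg_succ : ∀ n, ∀ t ∈ J, g (n + 1) t = g n t + d n (dyadicCell ω Ω (n + 1) t) := by
    intro n t ht
    have h : ∃ r ∈ J, dyadicCell ω Ω (n + 1) r = dyadicCell ω Ω (n + 1) t := ⟨t, ht, rfl⟩
    simp only [hg, hd, if_pos h, dyadicCell_succ_div_two]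
    abel
  set N4 : L2 → ℝ → ℝ≥0∞ := fun h t => eLpNorm (freeProp t h) 4 volume with hN4
  have hN4m : ∀ h, Measurable (N4 h) := fun h => measurable_eLpNorm_freeProp 4 h
  set R : ℝ → ℝ≥0∞ := fun t => N4 (F 0 0) t + N4 (F 0 1) t with hR
  -- the values of one generation are summed in `ℓ⁴`, which costs only their number to the `1/4`
  set Q : ℕ → ℝ → ℝ≥0∞ := fun n t =>
    (∑ j ∈ Finset.range (2 ^ (n + 1) + 1), N4 (d n j) t ^ 4) ^ (1 / 4 : ℝ) with hQ
  have hQm : ∀ n, Measurable (Q n) := by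
    intro n
    exact (Finset.measurable_fun_sum _ fun j _ => (hN4m (d n j)).pow_const 4).pow_const _
  have hQ4 : ∀ n t, Q n t ^ 4 = ∑ j ∈ Finset.range (2 ^ (n + 1) + 1), N4 (d n j) t ^ 4 := by
    intro n t
    simp only [hQ]
    rw [← ENNReal.rpow_natCast, ← ENNReal.rpow_mul]
    norm_num
  have hstep : ∀ N, ∀ t ∈ J, N4 (g N t) t ≤ R t + ∑ n ∈ Finset.range N, Q n t := by
    intro N t ht
    induction N with
    | zero =>
      simp only [Finset.range_zero, Finset.sum_empty, add_zero]
      have h1 := dyadicCell_le (hω0 t ht) (hω t ht) 0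
      rw [pow_zero] at h1
      simp only [hg, hR]
      interval_cases h : dyadicCell ω Ω 0 t
      · exact le_self_add
      · exact le_add_self
    | succ N ih =>
      rw [Finset.sum_range_succ, ← add_assoc, hg_succ N t ht]
      have h1 : N4 (g N t + d N (dyadicCell ω Ω (N + 1) t)) t ≤
          N4 (g N t) t + N4 (d N (dyadicCell ω Ω (N + 1) t)) t := by
        simp only [hN4]
        have h2 : freeProp t (g N t + d N (dyadicCell ω Ω (N + 1) t)) =
            freeProp t (g N t) + freeProp t (d N (dyadicCell ω Ω (N + 1) t)) := by
          have := freeProp_sub t (g N t + d N (dyadicCell ω Ω (N + 1) t)) (g N t)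
          rw [add_sub_cancel_left] at this
          rw [this]; abel
        rw [h2, eLpNorm_congr_ae (Lp.coeFn_add _ _)]
        exact eLpNorm_add_le (Lp.aestronglyMeasurable _) (Lp.aestronglyMeasurable _) (by norm_num)
      refine h1.trans (add_le_add ih ?_)
      refine (ENNReal.pow_le_pow_left_iff (n := 4) (by norm_num)).1 ?_
      rw [hQ4]
      refine Finset.single_le_sum (f := fun j => N4 (d N j) t ^ 4) (fun _ _ => zero_le) ?_
      rw [Finset.mem_range]
      exact Nat.lt_succ_of_le (dyadicCell_le (hω0 t ht) (hω t ht) (N + 1))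
  have hL4 : ∀ h : L2, eLpNorm (N4 h) 4 volume ≤ ‖h‖ₑ := by
    intro h
    refine (ENNReal.pow_le_pow_left_iff (n := 4) (by norm_num)).1 ?_
    rw [eLpNorm_four_pow]
    exact lintegral_eLpNorm_freeProp_le h
  have hRn : eLpNorm R 4 volume ≤ ENNReal.ofReal (2 * ‖f t₀‖ + 2 * W) := by
    have hF0 : ∀ j, ‖F 0 j‖ₑ ≤ ENNReal.ofReal (‖f t₀‖ + W) := by
      intro j
      rw [← ofReal_norm]
      apply ENNReal.ofReal_le_ofReal
      have h1 : ‖f (s 0 j) - f t₀‖ ≤ W := by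
        refine (hf _ ht₀ _ (hsJ 0 j)).trans (Real.rpow_le_rpow (abs_nonneg _) ?_ (by norm_num))
        rw [abs_le]
        constructor <;> linarith [hω0 _ ht₀, hω _ ht₀, hω0 _ (hsJ 0 j), hω _ (hsJ 0 j)]
      have h2 := norm_le_norm_add_norm_sub' (f (s 0 j)) (f t₀)
      simp only [hF]
      linarith
    refine (eLpNorm_add_le (hN4m _).aestronglyMeasurable (hN4m _).aestronglyMeasurable
      (by norm_num)).trans ?_
    refine (add_le_add ((hL4 _).trans (hF0 0)) ((hL4 _).trans (hF0 1))).trans ?_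
    rw [← ENNReal.ofReal_add (by positivity) (by positivity)]
    apply ENNReal.ofReal_le_ofReal
    linarith
  have hQn : ∀ n, eLpNorm (Q n) 4 volume ≤ ENNReal.ofReal (2 * W * (3 / 4) ^ n) := by
    intro n
    refine (ENNReal.pow_le_pow_left_iff (n := 4) (by norm_num)).1 ?_
    rw [eLpNorm_four_pow]
    simp only [enorm_eq_self, hQ4]
    rw [lintegral_finsetSum _ fun j _ => (hN4m (d n j)).pow_const 4]
    have h1 : ∀ j ∈ Finset.range (2 ^ (n + 1) + 1), ∫⁻ t, N4 (d n j) t ^ 4 ≤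
        ENNReal.ofReal ((Ω / 2 ^ n) ^ 3) := by
      intro j _
      refine (lintegral_eLpNorm_freeProp_le _).trans ?_
      rw [← ofReal_norm, ← ENNReal.ofReal_pow (norm_nonneg _), ← hpow _ (by positivity)]
      apply ENNReal.ofReal_le_ofReal
      exact pow_le_pow_left₀ (norm_nonneg _) (hd_le n j) 4
    refine (Finset.sum_le_sum h1).trans ?_
    rw [Finset.sum_const, Finset.card_range, nsmul_eq_mul, ← ENNReal.ofReal_natCast,
      ← ENNReal.ofReal_mul (by positivity), ← ENNReal.ofReal_pow (by positivity)]
    apply ENNReal.ofReal_le_ofReal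
    rw [mul_pow, mul_pow, hW4, div_pow, pow_right_comm (3 / 4 : ℝ) n 4]
    have h2 : ((2 ^ (n + 1) + 1 : ℕ) : ℝ) ≤ 4 * 2 ^ n := by
      push_cast
      rw [pow_succ]
      linarith [one_le_pow₀ (M₀ := ℝ) (a := 2) (n := n) (by norm_num)]
    calc ((2 ^ (n + 1) + 1 : ℕ) : ℝ) * (Ω ^ 3 / (2 ^ n) ^ 3) ≤
        4 * 2 ^ n * (Ω ^ 3 / (2 ^ n) ^ 3) := by gcongr
      _ = 4 * Ω ^ 3 * (1 / 4) ^ n := by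
        have : (1 / 4 : ℝ) ^ n = 1 / (2 ^ n) ^ 2 := by
          rw [← pow_mul, mul_comm, pow_mul, one_div_pow]; norm_num
        rw [this]; field_simp
      _ ≤ 2 ^ 4 * Ω ^ 3 * ((3 / 4) ^ 4) ^ n := by
        gcongr <;> norm_num
  have hS : ∀ N, ∫⁻ t, (R t + ∑ n ∈ Finset.range N, Q n t) ^ 4 ≤
      ENNReal.ofReal (2 * ‖f t₀‖ + 10 * W) ^ 4 := by
    intro N
    have h1 := eLpNorm_four_pow volume (fun t => R t + ∑ n ∈ Finset.range N, Q n t)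
    simp only [enorm_eq_self] at h1
    rw [← h1]
    gcongr
    have hRm : Measurable R := (hN4m _).add (hN4m _)
    have h2 : eLpNorm (fun t => ∑ n ∈ Finset.range N, Q n t) 4 volume ≤
        ∑ n ∈ Finset.range N, eLpNorm (Q n) 4 volume := by
      have := eLpNorm_sum_le (f := Q) (s := Finset.range N) (μ := volume) (p := 4)
        (fun n _ => (hQm n).aestronglyMeasurable) (by norm_num)
      rwa [show ∑ n ∈ Finset.range N, Q n = fun t => ∑ n ∈ Finset.range N, Q n t by
        ext t; simp] at this
    refine (eLpNorm_add_le hRm.aestronglyMeasurable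
      (Finset.measurable_fun_sum _ fun n _ => hQm n).aestronglyMeasurable (by norm_num)).trans ?_
    refine (add_le_add hRn (h2.trans (Finset.sum_le_sum fun n _ => hQn n))).trans ?_
    rw [← ENNReal.ofReal_sum_of_nonneg fun n _ => by positivity,
      ← ENNReal.ofReal_add (by positivity) (Finset.sum_nonneg fun n _ => by positivity)]
    apply ENNReal.ofReal_le_ofReal
    rw [← Finset.mul_sum]
    have h3 : ∑ n ∈ Finset.range N, (3 / 4 : ℝ) ^ n ≤ 4 := by
      have h4 := (summable_geometric_of_lt_one (r := (3 / 4 : ℝ)) (by norm_num) (by norm_num)).sum_le_tsum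
        (Finset.range N) (fun n _ => by positivity)
      rw [tsum_geometric_of_lt_one (by norm_num) (by norm_num)] at h4
      linarith
    nlinarith
  have hpt : ∀ t ∈ J, eLpNorm (freeProp t (f t)) 4 volume ^ 4 ≤
      liminf (fun N => (R t + ∑ n ∈ Finset.range N, Q n t) ^ 4) atTop := by
    intro t ht
    have h1 : LowerSemicontinuous fun f : L2 => eLpNorm f 4 volume ^ 4 :=
      (ENNReal.continuous_pow 4).comp_lowerSemicontinuous (lowerSemicontinuous_eLpNorm 4)
        (fun a b hab => pow_le_pow_left' hab 4)
    have h0 : Tendsto (fun N => g N t) atTop (𝓝 (f t)) := by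
      rw [tendsto_iff_norm_sub_tendsto_zero]
      have h3 : Tendsto (fun N : ℕ => (Ω / 2 ^ N) ^ (3 / 4 : ℝ)) atTop (𝓝 0) := by
        have h4 : Tendsto (fun N : ℕ => Ω / 2 ^ N) atTop (𝓝 0) :=
          tendsto_const_nhds.div_atTop (tendsto_pow_atTop_atTop_of_one_lt (by norm_num))
        have h5 := h4.rpow_const (p := (3 / 4 : ℝ)) (Or.inr (by norm_num))
        rwa [Real.zero_rpow (by norm_num)] at h5
      refine squeeze_zero (fun _ => norm_nonneg _) (fun N => ?_) h3
      exact hclose N _ (hsJ _ _) t ht (hs' N t ht)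
    have h2 : Tendsto (fun N => freeProp t (g N t)) atTop (𝓝 (freeProp t (f t))) :=
      ((isometry_freeProp t).continuous.tendsto (f t)).comp h0
    refine (lowerSemicontinuousAt_iff_le_liminf.1 (h1 _)).trans
      ((liminf_le_liminf_of_le h2).trans ?_)
    exact liminf_le_liminf (Eventually.of_forall fun N => pow_le_pow_left' (hstep N t ht) 4)
  calc _ ≤ ∫⁻ t in J, liminf (fun N => (R t + ∑ n ∈ Finset.range N, Q n t) ^ 4) atTop :=
        setLIntegral_mono' hJ hpt
    _ ≤ ∫⁻ t, liminf (fun N => (R t + ∑ n ∈ Finset.range N, Q n t) ^ 4) atTop :=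
        setLIntegral_le_lintegral _ _
    _ ≤ liminf (fun N => ∫⁻ t, (R t + ∑ n ∈ Finset.range N, Q n t) ^ 4) atTop :=
        lintegral_liminf_le fun N => (((hN4m _).add (hN4m _)).add
          (Finset.measurable_fun_sum _ fun n _ => hQm n)).pow_const 4
    _ ≤ _ := by
        refine liminf_le_of_le (by isBoundedDefault) (fun b hb => ?_)
        obtain ⟨N, hN⟩ := hb.exists
        exact hN.trans (hS N)

/-! ### Pairing with Schwartz functions -/

/-- The bilinear pairing `(F, H) ↦ ∫ F H` on `L²`. -/
def pairing : L2 →L[ℂ] L2 →L[ℂ] ℂ := (ContinuousLinearMap.mul ℂ ℂ).lpPairing volume 2 2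

lemma pairing_apply (F H : L2) : pairing F H = ∫ x, F x * H x := by
  simp [pairing, ContinuousLinearMap.lpPairing_eq_integral]

lemma pairing_toLp (F : L2) (φ : 𝓢(Plane, ℂ)) : pairing F (φ.toLp 2 volume) = ∫ x, F x * φ x := by
  rw [pairing_apply]
  refine integral_congr_ae ?_
  filter_upwards [φ.coeFn_toLp 2 volume] with x hx
  rw [hx]

lemma pairing_fourier_toLp (F : L2) (χ : 𝓢(Plane, ℂ)) :
    pairing (𝓕 F) (χ.toLp 2 volume) = pairing F ((𝓕 χ).toLp 2 volume) := by
  have h := congrArg (fun T : 𝓢'(Plane, ℂ) => T χ) (Lp.fourier_toTemperedDistribution_eq F)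
  simp only [TemperedDistribution.fourier_apply, Lp.toTemperedDistribution_apply,
    smul_eq_mul] at h
  rw [pairing_toLp, pairing_toLp]
  simp_rw [mul_comm (F _), mul_comm ((𝓕 F : L2) _)]
  exact h.symm

/-- `L²` norms are computed by testing against Schwartz functions. -/
lemma norm_le_of_pairing_toLp_le {F : L2} {M : ℝ} (hM : 0 ≤ M)
    (h : ∀ χ : 𝓢(Plane, ℂ), ‖pairing F (χ.toLp 2 volume)‖ ≤ M * ‖χ.toLp 2 volume‖) : ‖F‖ ≤ M := by
  have h1 : ∀ H : L2, ‖pairing F H‖ ≤ M * ‖H‖ := by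
    intro H
    refine DenseRange.induction_on (p := fun H : L2 => ‖pairing F H‖ ≤ M * ‖H‖)
      (SchwartzMap.denseRange_toLpCLM (E := Plane) (F := ℂ) (p := 2) ENNReal.ofNat_ne_top) H ?_ h
    exact isClosed_le (by fun_prop) (by fun_prop)
  have hstar : ‖(star F : L2)‖ = ‖F‖ := by
    rw [Lp.norm_def, Lp.norm_def]
    congr 1
    refine eLpNorm_congr_norm_ae ?_
    filter_upwards [Lp.coeFn_star F] with x hx
    rw [hx, Pi.star_apply, norm_star]
  have h2 : pairing F (star F) = ((‖F‖ ^ 2 : ℝ) : ℂ) := by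
    have h3 := inner_self_eq_norm_sq_to_K (𝕜 := ℂ) F
    rw [L2.inner_def] at h3
    rw [pairing_apply]
    push_cast
    rw [← Complex.coe_algebraMap, ← h3]
    refine integral_congr_ae ?_
    filter_upwards [Lp.coeFn_star F] with x hx
    rw [hx, Pi.star_apply]
    simp [Complex.mul_conj, Complex.normSq_eq_norm_sq]
  have h4 := h1 (star F)
  rw [h2, hstar, Complex.norm_real, Real.norm_of_nonneg (by positivity)] at h4
  rcases (norm_nonneg F).eq_or_lt with h0 | h0
  · rw [← h0]; exact hM
  · nlinarith

/-- Multiplication of a Schwartz function by `|2πξ|²`. -/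
def energyMul (χ : 𝓢(Plane, ℂ)) : 𝓢(Plane, ℂ) :=
  SchwartzMap.smulLeftCLM ℂ (fun ξ : Plane => (2 * Real.pi * ‖ξ‖) ^ 2) χ

lemma energyMul_apply (χ : 𝓢(Plane, ℂ)) (ξ : Plane) :
    energyMul χ ξ = (((2 * Real.pi * ‖ξ‖) ^ 2 : ℝ) : ℂ) * χ ξ := by
  have h : (fun ξ : Plane => (2 * Real.pi * ‖ξ‖) ^ 2).HasTemperateGrowth := by
    have : (fun ξ : Plane => (2 * Real.pi * ‖ξ‖) ^ 2) =
        fun ξ : Plane => (2 * Real.pi) ^ 2 * ‖ξ‖ ^ 2 := by ext; ring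
    rw [this]
    fun_prop
  rw [energyMul, SchwartzMap.smulLeftCLM_apply_apply h]
  simp

lemma laplacian_fourier (χ : 𝓢(Plane, ℂ)) :
    Δ (𝓕 χ : 𝓢(Plane, ℂ)) = -𝓕 (energyMul χ) := by
  rw [SchwartzMap.laplacian_eq_sum (stdOrthonormalBasis ℝ Plane)]
  simp_rw [SchwartzMap.lineDerivOp_fourier_eq]
  rw [← FourierTransform.fourierCLM_apply (R := ℂ) (energyMul χ), ← map_neg]
  simp_rw [← FourierTransform.fourierCLM_apply (R := ℂ)]
  rw [← map_sum]
  congr 1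
  ext ξ
  have ht : ∀ m : Plane, (fun ξ : Plane => inner ℝ ξ m).HasTemperateGrowth := by
    intro m; fun_prop
  have hs := (stdOrthonormalBasis ℝ Plane).sum_sq_inner_left ξ
  have hs' : ((‖ξ‖ ^ 2 : ℝ) : ℂ) = ∑ i, ((inner ℝ ξ (stdOrthonormalBasis ℝ Plane i) : ℝ) : ℂ) ^ 2 := by
    rw [← hs]; push_cast; rfl
  rw [sum_apply, neg_apply, energyMul_apply]
  simp only [smul_apply, SchwartzMap.smulLeftCLM_apply_apply (ht _), smul_eq_mul,
    Complex.real_smul]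
  rw [mul_pow, Complex.ofReal_mul, hs', Finset.mul_sum, Finset.sum_mul, ← Finset.sum_neg_distrib]
  refine Finset.sum_congr rfl fun i _ => ?_
  push_cast
  linear_combination (4 * (Real.pi : ℂ) ^ 2 *
    ((inner ℝ ξ (stdOrthonormalBasis ℝ Plane i) : ℝ) : ℂ) ^ 2 * χ ξ) * Complex.I_sq

lemma norm_cexp_mul_I_sub_le (θ : ℝ) :
    ‖Complex.exp ((θ : ℂ) * Complex.I) - 1 - (θ : ℂ) * Complex.I‖ ≤ 3 * θ ^ 2 := by
  have hn : ‖(θ : ℂ) * Complex.I‖ = |θ| := by simp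
  rcases le_or_gt |θ| 1 with h | h
  · refine (Complex.norm_exp_sub_one_sub_id_le (by rwa [hn])).trans ?_
    rw [hn, sq_abs]
    nlinarith [sq_nonneg θ]
  · refine (norm_sub_le _ _).trans ((add_le_add (norm_sub_le _ _) le_rfl).trans ?_)
    rw [Complex.norm_exp_ofReal_mul_I, hn, norm_one]
    nlinarith [sq_abs θ]

/-- The multipliers `e^{it|2πξ|²}` are differentiable in time in `L²` on Schwartz functions: the
remainder of second order is at most a multiple of `(s - t)² |2πξ|⁴ |χ|`. -/
lemma hasDerivAt_symbolMul_neg (χ : 𝓢(Plane, ℂ)) (t : ℝ) :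
    HasDerivAt (fun s => (symbolMul (-s) χ).toLp 2 volume)
      (Complex.I • (energyMul (symbolMul (-t) χ)).toLp 2 volume) t := by
  have hkey : ∀ s : ℝ, ‖(symbolMul (-s) χ).toLp 2 volume - (symbolMul (-t) χ).toLp 2 volume -
      (s - t) • (Complex.I • (energyMul (symbolMul (-t) χ)).toLp 2 volume)‖ ≤
      (3 * ‖(energyMul (energyMul χ)).toLp 2 volume‖) * ‖s - t‖ ^ 2 := by
    intro s
    rw [show (3 * ‖(energyMul (energyMul χ)).toLp 2 volume‖) * ‖s - t‖ ^ 2 =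
      (3 * ‖s - t‖ ^ 2) * ‖(energyMul (energyMul χ)).toLp 2 volume‖ by ring]
    refine Lp.norm_le_mul_norm_of_ae_le_mul ?_
    filter_upwards [Lp.coeFn_sub ((symbolMul (-s) χ).toLp 2 volume -
        (symbolMul (-t) χ).toLp 2 volume)
        ((s - t) • (Complex.I • (energyMul (symbolMul (-t) χ)).toLp 2 volume)),
      Lp.coeFn_sub ((symbolMul (-s) χ).toLp 2 volume) ((symbolMul (-t) χ).toLp 2 volume),
      Lp.coeFn_smul (s - t) (Complex.I • (energyMul (symbolMul (-t) χ)).toLp 2 volume),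
      Lp.coeFn_smul Complex.I ((energyMul (symbolMul (-t) χ)).toLp 2 volume),
      (symbolMul (-s) χ).coeFn_toLp 2 volume, (symbolMul (-t) χ).coeFn_toLp 2 volume,
      (energyMul (symbolMul (-t) χ)).coeFn_toLp 2 volume,
      (energyMul (energyMul χ)).coeFn_toLp 2 volume] with ξ h1 h2 h3 h4 h5 h6 h7 h8
    rw [h1, Pi.sub_apply, h2, Pi.sub_apply, h3, Pi.smul_apply, h4, Pi.smul_apply, h5, h6, h7, h8]
    simp only [energyMul_apply, symbolMul_apply, smul_eq_mul, Complex.real_smul]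
    set ρ : ℝ := (2 * Real.pi * ‖ξ‖) ^ 2 with hρ
    have hsym : schrodingerSymbol (-s) ξ = schrodingerSymbol (-t) ξ *
        Complex.exp ((((s - t) * ρ : ℝ) : ℂ) * Complex.I) := by
      unfold schrodingerSymbol
      rw [← Complex.exp_add]
      congr 1
      push_cast [hρ]
      ring
    rw [hsym]
    have e : schrodingerSymbol (-t) ξ * Complex.exp ((((s - t) * ρ : ℝ) : ℂ) * Complex.I) * χ ξ -
        schrodingerSymbol (-t) ξ * χ ξ -
        ((s - t : ℝ) : ℂ) * (Complex.I * ((ρ : ℂ) * (schrodingerSymbol (-t) ξ * χ ξ))) =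
        schrodingerSymbol (-t) ξ * χ ξ * (Complex.exp ((((s - t) * ρ : ℝ) : ℂ) * Complex.I) - 1 -
          (((s - t) * ρ : ℝ) : ℂ) * Complex.I) := by
      push_cast; ring
    rw [e, norm_mul, norm_mul, norm_schrodingerSymbol, one_mul, norm_mul, norm_mul,
      Complex.norm_real, Real.norm_of_nonneg (by positivity : 0 ≤ ρ)]
    refine (mul_le_mul_of_nonneg_left (norm_cexp_mul_I_sub_le _) (norm_nonneg _)).trans ?_
    rw [Real.norm_eq_abs, sq_abs]
    apply le_of_eq
    ring
  rw [hasDerivAt_iff_isLittleO]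
  refine (Asymptotics.IsBigO.of_bound (3 * ‖(energyMul (energyMul χ)).toLp 2 volume‖)
    (Eventually.of_forall fun s => ?_)).trans_isLittleO
    (Asymptotics.isLittleO_pow_sub_sub t (m := 2) (by norm_num))
  rw [norm_pow, norm_norm]
  exact hkey s

/-! ### The dual Strichartz estimate -/

/-- The interaction picture `e^{-itΔ} v(t)` of a path `v`. -/
def profile (v : ℝ → L2) (t : ℝ) : L2 := freeProp (-t) (v t)

/-- The test function `𝓕(e^{it|2πξ|²} χ)`, a solution of the adjoint free equation. -/
def testWave (χ : 𝓢(Plane, ℂ)) (t : ℝ) : 𝓢(Plane, ℂ) := 𝓕 (symbolMul (-t) χ)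

lemma pairing_testWave (v : ℝ → L2) (χ : 𝓢(Plane, ℂ)) (t : ℝ) :
    pairing (v t) ((testWave χ t).toLp 2 volume) =
      pairing (𝓕 (profile v t)) (χ.toLp 2 volume) := by
  rw [testWave, ← pairing_fourier_toLp, pairing_toLp, pairing_toLp]
  refine integral_congr_ae ?_
  filter_upwards [fourier_freeProp_ae (-t) (v t)] with ξ h
  rw [profile, h, symbolMul_apply]
  ring

lemma hasDerivAt_testWave (χ : 𝓢(Plane, ℂ)) (t : ℝ) :
    HasDerivAt (fun s => (testWave χ s).toLp 2 volume)
      (-Complex.I • (Δ (testWave χ t)).toLp 2 volume) t := by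
  have h := (((Lp.fourierTransformₗᵢ Plane ℂ).toContinuousLinearEquiv.toContinuousLinearMap.restrictScalars
    ℝ).hasFDerivAt).comp_hasDerivAt t (hasDerivAt_symbolMul_neg χ t)
  have e1 : ∀ φ : 𝓢(Plane, ℂ), (Lp.fourierTransformₗᵢ Plane ℂ) (φ.toLp 2 volume) =
      (𝓕 φ).toLp 2 volume := fun φ => SchwartzMap.toLp_fourier_eq φ
  refine (h.congr_deriv ?_).congr_of_eventuallyEq (Eventually.of_forall fun s => ?_)
  · rw [testWave, laplacian_fourier]
    change (Lp.fourierTransformₗᵢ Plane ℂ) (Complex.I • _) = _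
    rw [map_smul, e1]
    have : (-𝓕 (energyMul (symbolMul (-t) χ)) : 𝓢(Plane, ℂ)).toLp 2 volume =
        -((𝓕 (energyMul (symbolMul (-t) χ)) : 𝓢(Plane, ℂ)).toLp 2 volume) :=
      map_neg (SchwartzMap.toLpCLM ℂ ℂ 2 (volume : Measure Plane)) _
    rw [this, smul_neg, neg_smul, neg_neg]
  · exact (e1 _).symm

lemma continuous_testWave (χ : 𝓢(Plane, ℂ)) : Continuous fun s => (testWave χ s).toLp 2 volume :=
  continuous_iff_continuousAt.2 fun t => (hasDerivAt_testWave χ t).continuousAt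

lemma measurable_eLpNorm_testWave (χ : 𝓢(Plane, ℂ)) (r : ℝ≥0∞) :
    Measurable fun t => eLpNorm (testWave χ t) r volume := by
  have h := ((lowerSemicontinuous_eLpNorm r).comp (continuous_testWave χ)).measurable
  convert h using 2 with t
  exact (eLpNorm_congr_ae ((testWave χ t).coeFn_toLp 2 volume)).symm

lemma lintegral_eLpNorm_testWave_le (χ : 𝓢(Plane, ℂ)) :
    ∫⁻ t, eLpNorm (testWave χ t) 4 volume ^ 4 ≤ ‖χ.toLp 2 volume‖ₑ ^ 4 := by
  refine le_trans (le_of_eq ?_) (lintegral_eLpNorm_fourier_symbolMul_le χ)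
  exact lintegral_neg_eq_self (fun t => eLpNorm (𝓕 (symbolMul t χ) : 𝓢(Plane, ℂ)) 4 volume ^ 4)
    (μ := volume)

/-- A product rule at a point where one factor is merely continuous and the other one, which is
differentiable, vanishes. -/
lemma hasDerivWithinAt_bilin_sub {E F G : Type*} [NormedAddCommGroup E] [NormedSpace ℂ E]
    [NormedAddCommGroup F] [NormedSpace ℂ F] [NormedAddCommGroup G] [NormedSpace ℂ G]
    (B : E →L[ℂ] F →L[ℂ] G) {J : Set ℝ} {t : ℝ} {v : ℝ → E} {Y : ℝ → F} {Y' : F}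
    (hv : ContinuousWithinAt v J t) (hY : HasDerivWithinAt Y Y' J t) :
    HasDerivWithinAt (fun s => B (v s) (Y s - Y t)) (B (v t) Y') J t := by
  rw [hasDerivWithinAt_iff_tendsto_slope] at hY ⊢
  have h4 : Tendsto v (𝓝[J \ {t}] t) (𝓝 (v t)) :=
    hv.mono_left (nhdsWithin_mono t Set.sdiff_subset)
  have h5 : Tendsto (fun s => B (v s) (slope Y t s)) (𝓝[J \ {t}] t) (𝓝 (B (v t) Y')) :=
    (B.continuous₂.tendsto (v t, Y')).comp (h4.prodMk_nhds hY)
  refine h5.congr fun s => ?_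
  rw [slope_def_module, slope_def_module, sub_self, map_zero, sub_zero,
    ContinuousLinearMap.map_smul_of_tower]

/-- Along a solution of `∂ₜv = i(Δv + F)`, the pairing with a free wave only sees the forcing. -/
lemma hasDerivWithinAt_pairing_testWave {J : Set ℝ} {v : ℝ → L2} {D : 𝓢(Plane, ℂ) → ℝ → ℂ} {t : ℝ}
    (hcont : ContinuousWithinAt v J t) (χ : 𝓢(Plane, ℂ))
    (hD : HasDerivWithinAt (fun s => ∫ x, v s x * testWave χ t x)
      (Complex.I * ((∫ x, v t x * (Δ (testWave χ t)) x) + D (testWave χ t) t)) J t) :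
    HasDerivWithinAt (fun s => pairing (v s) ((testWave χ s).toLp 2 volume))
      (Complex.I * D (testWave χ t) t) J t := by
  set Y : ℝ → L2 := fun s => (testWave χ s).toLp 2 volume with hY
  have h1 : HasDerivWithinAt (fun s => pairing (v s) (Y t))
      (Complex.I * (pairing (v t) ((Δ (testWave χ t)).toLp 2 volume) + D (testWave χ t) t)) J t := by
    simp only [hY, pairing_toLp]
    exact hD
  have h2 : HasDerivWithinAt (fun s => pairing (v s) (Y s - Y t))
      (pairing (v t) (-Complex.I • (Δ (testWave χ t)).toLp 2 volume)) J t :=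
    hasDerivWithinAt_bilin_sub pairing hcont (hasDerivAt_testWave χ t).hasDerivWithinAt
  have h6 := h1.add h2
  refine (h6.congr_deriv ?_).congr_of_eventuallyEq (Eventually.of_forall fun s => ?_) ?_
  · rw [map_smul, smul_eq_mul]; ring
  · simp only [Pi.add_apply, map_sub, hY]; ring
  · simp only [Pi.add_apply, map_sub, hY]; ring

/-- The dual Strichartz estimate for a distributional solution `v` of `∂ₜv = i(Δv + F)`: if the
forcing satisfies `‖F(t)‖_{L^{4/3}} ≤ G(t)`, in the weak sense of `hG`, then the increments of
the profile are bounded by the `L^{4/3}` norm in time of `G`. -/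
theorem enorm_profile_sub_le {a b : ℝ} {v : ℝ → L2} {D : 𝓢(Plane, ℂ) → ℝ → ℂ} {G : ℝ → ℝ≥0∞}
    (hcont : ContinuousOn v (Set.Icc a b))
    (hD : ∀ φ : 𝓢(Plane, ℂ), ∀ t ∈ Set.Icc a b, HasDerivWithinAt (fun s => ∫ x, v s x * φ x)
      (Complex.I * ((∫ x, v t x * (Δ φ) x) + D φ t)) (Set.Icc a b) t)
    (hGm : AEMeasurable G (volume.restrict (Set.Icc a b)))
    (hG : ∀ᵐ t ∂(volume.restrict (Set.Icc a b)), ∀ φ : 𝓢(Plane, ℂ),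
      ‖D φ t‖ₑ ≤ G t * eLpNorm φ 4 volume)
    (hGfin : ∫⁻ t in Set.Icc a b, G t ^ (4 / 3 : ℝ) ≠ ∞) {s t : ℝ} (hs : a ≤ s) (hst : s ≤ t)
    (ht : t ≤ b) :
    ‖profile v t - profile v s‖ₑ ≤ (∫⁻ τ in Set.Icc s t, G τ ^ (4 / 3 : ℝ)) ^ (3 / 4 : ℝ) := by
  have hsub : Set.Icc s t ⊆ Set.Icc a b := Set.Icc_subset_Icc hs ht
  set X : ℝ≥0∞ := (∫⁻ τ in Set.Icc s t, G τ ^ (4 / 3 : ℝ)) ^ (3 / 4 : ℝ) with hX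
  have hXfin : X ≠ ∞ := ENNReal.rpow_ne_top_of_nonneg (by norm_num)
    ((lintegral_mono_set hsub).trans_lt hGfin.lt_top).ne
  rw [← ofReal_norm, ← Lp.norm_fourier_eq]
  refine ENNReal.ofReal_le_of_le_toReal ?_
  refine norm_le_of_pairing_toLp_le ENNReal.toReal_nonneg fun χ => ?_
  rw [fourier_sub', map_sub, sub_apply, ← pairing_testWave, ← pairing_testWave]
  set d : ℝ → ℂ := fun τ => pairing (v τ) ((testWave χ τ).toLp 2 volume) with hd
  have hderiv : ∀ τ ∈ Set.Icc a b, HasDerivWithinAt d (Complex.I * D (testWave χ τ) τ)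
      (Set.Icc a b) τ := fun τ hτ =>
    hasDerivWithinAt_pairing_testWave (hcont τ hτ) χ (hD _ τ hτ)
  have hderiv' : ∀ τ ∈ Set.Ioo s t, HasDerivAt d (Complex.I * D (testWave χ τ) τ) τ := by
    intro τ hτ
    exact (hderiv τ (hsub (Set.Ioo_subset_Icc_self hτ))).hasDerivAt
      (Icc_mem_nhds (hs.trans_lt hτ.1) (hτ.2.trans_le ht))
  have hbound : ∫⁻ τ in Set.Icc s t, ‖Complex.I * D (testWave χ τ) τ‖ₑ ≤
      X * ‖χ.toLp 2 volume‖ₑ := by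
    have h1 : ∀ᵐ τ ∂(volume.restrict (Set.Icc s t)), ‖Complex.I * D (testWave χ τ) τ‖ₑ ≤
        (G * fun τ => eLpNorm (testWave χ τ) 4 volume) τ := by
      filter_upwards [ae_restrict_of_ae_restrict_of_subset hsub hG] with τ hτ
      rw [enorm_mul, show ‖Complex.I‖ₑ = 1 by rw [← ofReal_norm]; simp, one_mul]
      exact hτ (testWave χ τ)
    refine (lintegral_mono_ae h1).trans ?_
    have hpq : (4 / 3 : ℝ).HolderConjugate 4 := by
      rw [Real.holderConjugate_iff]; norm_num
    refine (ENNReal.lintegral_mul_le_Lp_mul_Lq _ hpq (hGm.mono_set hsub)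
      (measurable_eLpNorm_testWave χ 4).aemeasurable).trans ?_
    rw [show (1 / (4 / 3) : ℝ) = 3 / 4 by norm_num]
    refine mul_le_mul' le_rfl ?_
    have h2 : ∫⁻ τ in Set.Icc s t, eLpNorm (testWave χ τ) 4 volume ^ (4 : ℝ) ≤
        ‖χ.toLp 2 volume‖ₑ ^ (4 : ℝ) := by
      refine (setLIntegral_le_lintegral _ _).trans ?_
      have := lintegral_eLpNorm_testWave_le χ
      exact_mod_cast this
    refine (ENNReal.rpow_le_rpow h2 (by norm_num)).trans ?_
    rw [← ENNReal.rpow_mul]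
    norm_num
  have hfin : X * ‖χ.toLp 2 volume‖ₑ ≠ ∞ := ENNReal.mul_ne_top hXfin enorm_ne_top
  have hmeas : AEStronglyMeasurable (fun τ => Complex.I * D (testWave χ τ) τ)
      (volume.restrict (Set.Ioo s t)) := by
    refine (measurable_deriv d).aestronglyMeasurable.congr ?_
    filter_upwards [ae_restrict_mem measurableSet_Ioo] with τ hτ
    exact (hderiv' τ hτ).deriv
  have hint : IntervalIntegrable (fun τ => Complex.I * D (testWave χ τ) τ) volume s t := by
    rw [intervalIntegrable_iff_integrableOn_Ioo_of_le hst]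
    refine ⟨hmeas, ?_⟩
    exact ((lintegral_mono_set Set.Ioo_subset_Icc_self).trans hbound).trans_lt hfin.lt_top
  have hFTC := intervalIntegral.integral_eq_sub_of_hasDerivAt_of_le hst
    (fun τ hτ => ((hderiv τ (hsub hτ)).continuousWithinAt).mono hsub) hderiv' hint
  rw [← hFTC, intervalIntegral.integral_of_le hst]
  have h3 : ‖∫ τ in Set.Ioc s t, Complex.I * D (testWave χ τ) τ‖ₑ ≤ X * ‖χ.toLp 2 volume‖ₑ :=
    (enorm_integral_le_lintegral_enorm _).trans
      ((lintegral_mono_set Set.Ioc_subset_Icc_self).trans hbound)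
  have h4 := ENNReal.toReal_mono hfin h3
  rwa [ENNReal.toReal_mul, toReal_enorm, toReal_enorm] at h4

/-! ### Propagation of smallness in `L²` -/

lemma freeProp_profile (v : ℝ → L2) (t : ℝ) : freeProp t (profile v t) = v t := by
  rw [profile, freeProp_freeProp, add_neg_cancel, freeProp_zero]

lemma norm_profile (v : ℝ → L2) (t : ℝ) : ‖profile v t‖ = ‖v t‖ := norm_freeProp _ _

lemma aemeasurable_eLpNorm_of_continuousOn {J : Set ℝ} (hJ : MeasurableSet J) {v : ℝ → L2}
    (hv : ContinuousOn v J) (r : ℝ≥0∞) :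
    AEMeasurable (fun t => eLpNorm (v t) r volume) (volume.restrict J) := by
  borelize L2
  exact (lowerSemicontinuous_eLpNorm r).measurable.comp_aemeasurable (hv.aemeasurable hJ)

/-- Hölder's inequality in time for `L² × L⁴ → L^{4/3}`. -/
lemma lintegral_mul_rpow_four_thirds_le {α : Type*} [MeasurableSpace α] {μ : Measure α}
    {k N : α → ℝ≥0∞} (hk : AEMeasurable k μ) (hN : AEMeasurable N μ) :
    (∫⁻ t, (k t * N t) ^ (4 / 3 : ℝ) ∂μ) ^ (3 / 4 : ℝ) ≤
      (∫⁻ t, k t ^ 2 ∂μ) ^ (1 / 2 : ℝ) * (∫⁻ t, N t ^ 4 ∂μ) ^ (1 / 4 : ℝ) := by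
  have hpq : (3 / 2 : ℝ).HolderConjugate 3 := by
    rw [Real.holderConjugate_iff]; norm_num
  have h := ENNReal.lintegral_mul_le_Lp_mul_Lq μ hpq (hk.pow_const (4 / 3 : ℝ))
    (hN.pow_const (4 / 3 : ℝ))
  have h2 := ENNReal.rpow_le_rpow h (show (0 : ℝ) ≤ 3 / 4 by norm_num)
  rw [ENNReal.mul_rpow_of_nonneg _ _ (by norm_num), ← ENNReal.rpow_mul, ← ENNReal.rpow_mul] at h2
  simp only [Pi.mul_apply, ← ENNReal.rpow_mul] at h2
  norm_num at h2
  simp_rw [ENNReal.mul_rpow_of_nonneg _ _ (show (0 : ℝ) ≤ 4 / 3 by norm_num)]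
  norm_num
  exact h2

/-- If the forcing of a solution is bounded by `k(t) ‖v(t)‖₄` with `k` small in `L²` in time,
then the Strichartz norm of `v` is bounded by the data, and the increments of the profile are
bounded by the data times the size of `k`. -/
theorem enorm_profile_sub_le_of_small {a b : ℝ} {v : ℝ → L2} {D : 𝓢(Plane, ℂ) → ℝ → ℂ}
    {k : ℝ → ℝ≥0∞} (hab : a ≤ b)
    (hcont : ContinuousOn v (Set.Icc a b))
    (hD : ∀ φ : 𝓢(Plane, ℂ), ∀ t ∈ Set.Icc a b, HasDerivWithinAt (fun s => ∫ x, v s x * φ x)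
      (Complex.I * ((∫ x, v t x * (Δ φ) x) + D φ t)) (Set.Icc a b) t)
    (hkm : AEMeasurable k (volume.restrict (Set.Icc a b)))
    (hk : ∀ᵐ t ∂(volume.restrict (Set.Icc a b)), ∀ φ : 𝓢(Plane, ℂ),
      ‖D φ t‖ₑ ≤ k t * eLpNorm (v t) 4 volume * eLpNorm φ 4 volume)
    (hfin : ∫⁻ t in Set.Icc a b, eLpNorm (v t) 4 volume ^ 4 ≠ ∞)
    (hsmall : (∫⁻ t in Set.Icc a b, k t ^ 2) ^ (1 / 2 : ℝ) ≤ ENNReal.ofReal (1 / 20))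
    {s t : ℝ} (hs : s ∈ Set.Icc a b) (ht : t ∈ Set.Icc a b) :
    ‖profile v t - profile v s‖ₑ ≤
      (∫⁻ t in Set.Icc a b, k t ^ 2) ^ (1 / 2 : ℝ) * (4 * ‖v a‖ₑ) := by
  set G : ℝ → ℝ≥0∞ := fun t => k t * eLpNorm (v t) 4 volume with hG
  set κ : ℝ≥0∞ := (∫⁻ t in Set.Icc a b, k t ^ 2) ^ (1 / 2 : ℝ) with hκ
  set N : ℝ≥0∞ := (∫⁻ t in Set.Icc a b, eLpNorm (v t) 4 volume ^ 4) ^ (1 / 4 : ℝ) with hN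
  have hNfin : N ≠ ∞ := ENNReal.rpow_ne_top_of_nonneg (by norm_num) hfin
  have hvm := aemeasurable_eLpNorm_of_continuousOn measurableSet_Icc hcont 4
  have hGm : AEMeasurable G (volume.restrict (Set.Icc a b)) := hkm.mul hvm
  have hκfin : κ ≠ ∞ := (hsmall.trans_lt ENNReal.ofReal_lt_top).ne
  have hhol : (∫⁻ t in Set.Icc a b, G t ^ (4 / 3 : ℝ)) ^ (3 / 4 : ℝ) ≤ κ * N :=
    lintegral_mul_rpow_four_thirds_le hkm hvm
  have hGfin : ∫⁻ t in Set.Icc a b, G t ^ (4 / 3 : ℝ) ≠ ∞ := by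
    intro h
    rw [h, ENNReal.top_rpow_of_pos (by norm_num)] at hhol
    exact (ENNReal.mul_ne_top hκfin hNfin) (top_le_iff.1 hhol)
  have hinc : ∀ s t, a ≤ s → s ≤ t → t ≤ b → ‖profile v t - profile v s‖ₑ ≤
      (∫⁻ τ in Set.Icc s t, G τ ^ (4 / 3 : ℝ)) ^ (3 / 4 : ℝ) := fun s t h1 h2 h3 =>
    enorm_profile_sub_le hcont hD hGm hk hGfin h1 h2 h3
  -- the monotone function that controls the path of profiles
  set ω : ℝ → ℝ := fun t => (∫⁻ τ in Set.Icc a t, G τ ^ (4 / 3 : ℝ)).toReal with hω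
  set Ω : ℝ := (∫⁻ τ in Set.Icc a b, G τ ^ (4 / 3 : ℝ)).toReal with hΩ
  have hfin' : ∀ t ≤ b, ∫⁻ τ in Set.Icc a t, G τ ^ (4 / 3 : ℝ) ≠ ∞ := fun t ht =>
    ((lintegral_mono_set (Set.Icc_subset_Icc le_rfl ht)).trans_lt hGfin.lt_top).ne
  have hadd : ∀ s t, a ≤ s → s ≤ t → t ≤ b →
      (∫⁻ τ in Set.Icc s t, G τ ^ (4 / 3 : ℝ)).toReal = ω t - ω s := by
    intro s t h1 h2 h3
    have e1 : ∫⁻ τ in Set.Icc a t, G τ ^ (4 / 3 : ℝ) =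
        (∫⁻ τ in Set.Icc a s, G τ ^ (4 / 3 : ℝ)) + ∫⁻ τ in Set.Ioc s t, G τ ^ (4 / 3 : ℝ) := by
      rw [← Set.Icc_union_Ioc_eq_Icc h1 h2]
      refine lintegral_union measurableSet_Ioc ?_
      rw [Set.disjoint_left]
      intro x hx hx'
      exact absurd hx.2 (not_le.2 hx'.1)
    have e2 : ∫⁻ τ in Set.Icc s t, G τ ^ (4 / 3 : ℝ) = ∫⁻ τ in Set.Ioc s t, G τ ^ (4 / 3 : ℝ) :=
      setLIntegral_congr Ioc_ae_eq_Icc.symm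
    have hf2 : ∫⁻ τ in Set.Ioc s t, G τ ^ (4 / 3 : ℝ) ≠ ∞ := by
      intro h
      rw [h, add_top] at e1
      exact hfin' t h3 e1
    simp only [hω]
    rw [e1, e2, ENNReal.toReal_add (hfin' s (h2.trans h3)) hf2]
    ring
  have hpath : ∀ s ∈ Set.Icc a b, ∀ t ∈ Set.Icc a b,
      ‖profile v t - profile v s‖ ≤ |ω t - ω s| ^ (3 / 4 : ℝ) := by
    have key : ∀ s t, a ≤ s → s ≤ t → t ≤ b →
        ‖profile v t - profile v s‖ ≤ |ω t - ω s| ^ (3 / 4 : ℝ) := by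
      intro s t h1 h2 h3
      have h4 := hinc s t h1 h2 h3
      have hf3 : ∫⁻ τ in Set.Icc s t, G τ ^ (4 / 3 : ℝ) ≠ ∞ :=
        ((lintegral_mono_set (Set.Icc_subset_Icc h1 h3)).trans_lt hGfin.lt_top).ne
      have h5 := ENNReal.toReal_mono (ENNReal.rpow_ne_top_of_nonneg (by norm_num) hf3) h4
      rw [toReal_enorm, ← ENNReal.toReal_rpow, hadd s t h1 h2 h3] at h5
      rwa [abs_of_nonneg]
      rw [← hadd s t h1 h2 h3]
      exact ENNReal.toReal_nonneg
    intro s hs t ht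
    rcases le_total s t with h | h
    · exact key s t hs.1 h ht.2
    · rw [norm_sub_rev, abs_sub_comm]
      exact key t s ht.1 h hs.2
  have ha : a ∈ Set.Icc a b := ⟨le_rfl, hab⟩
  have hstr := lintegral_eLpNorm_freeProp_path_le (f := profile v) (ω := ω) (Ω := Ω) ha
    (fun t _ => ENNReal.toReal_nonneg)
    (fun t ht => ENNReal.toReal_mono hGfin (lintegral_mono_set (Set.Icc_subset_Icc le_rfl ht.2)))
    hpath measurableSet_Icc
  simp_rw [freeProp_profile, norm_profile] at hstr
  have hN1 : N ≤ ENNReal.ofReal (2 * ‖v a‖ + 10 * Ω ^ (3 / 4 : ℝ)) := by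
    have h1 := ENNReal.rpow_le_rpow hstr (show (0 : ℝ) ≤ 1 / 4 by norm_num)
    refine h1.trans (le_of_eq ?_)
    rw [← ENNReal.rpow_natCast, ← ENNReal.rpow_mul]
    norm_num
  have hΩ1 : ENNReal.ofReal (Ω ^ (3 / 4 : ℝ)) ≤ κ * N := by
    rw [hΩ, ENNReal.toReal_rpow, ENNReal.ofReal_toReal
      (ENNReal.rpow_ne_top_of_nonneg (by norm_num) hGfin)]
    exact hhol
  -- the smallness of `κ` absorbs the Strichartz norm on the right
  have hN2 : N ≤ 4 * ‖v a‖ₑ := by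
    have hκN : (κ * N).toReal ≤ 1 / 20 * N.toReal := by
      rw [ENNReal.toReal_mul]
      refine mul_le_mul_of_nonneg_right ?_ ENNReal.toReal_nonneg
      exact ENNReal.toReal_le_of_le_ofReal (by norm_num) hsmall
    have h1 : Ω ^ (3 / 4 : ℝ) ≤ (κ * N).toReal := by
      exact (ENNReal.ofReal_le_iff_le_toReal (ENNReal.mul_ne_top hκfin hNfin)).1 hΩ1
    have h2 : N.toReal ≤ 2 * ‖v a‖ + 10 * Ω ^ (3 / 4 : ℝ) :=
      ENNReal.toReal_le_of_le_ofReal (by positivity) hN1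
    have h3 : N.toReal ≤ 4 * ‖v a‖ := by linarith
    rw [← ENNReal.ofReal_toReal hNfin, ← ofReal_norm, show (4 : ℝ≥0∞) = ENNReal.ofReal 4 by simp,
      ← ENNReal.ofReal_mul (by norm_num)]
    exact ENNReal.ofReal_le_ofReal h3
  have hfinal : ∀ s t, a ≤ s → s ≤ t → t ≤ b →
      ‖profile v t - profile v s‖ₑ ≤ κ * (4 * ‖v a‖ₑ) := by
    intro s t h1 h2 h3
    calc _ ≤ (∫⁻ τ in Set.Icc s t, G τ ^ (4 / 3 : ℝ)) ^ (3 / 4 : ℝ) := hinc s t h1 h2 h3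
      _ ≤ (∫⁻ τ in Set.Icc a b, G τ ^ (4 / 3 : ℝ)) ^ (3 / 4 : ℝ) :=
        ENNReal.rpow_le_rpow (lintegral_mono_set (Set.Icc_subset_Icc h1 h3)) (by norm_num)
      _ ≤ κ * N := hhol
      _ ≤ _ := mul_le_mul' le_rfl hN2
  rcases le_total s t with h | h
  · exact hfinal s t hs.1 h ht.2
  · rw [enorm_sub_rev]
    exact hfinal t s ht.1 h hs.2

/-! ### Translations and the `H¹` norm -/

/-- The translation `f ↦ f(· + h)` on `L²`. -/
def translate (h : Plane) : L2 →ₗᵢ[ℂ] L2 :=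
  Lp.compMeasurePreservingₗᵢ ℂ (fun x => x + h) (measurePreserving_add_right volume h)

lemma translate_ae (h : Plane) (f : L2) : translate h f =ᵐ[volume] fun x => f (x + h) :=
  Lp.coeFn_compMeasurePreserving f (measurePreserving_add_right volume h)

lemma eLpNorm_translate (h : Plane) (f : L2) (r : ℝ≥0∞) :
    eLpNorm (translate h f) r volume = eLpNorm f r volume := by
  rw [eLpNorm_congr_ae (translate_ae h f)]
  exact eLpNorm_comp_measurePreserving (Lp.aestronglyMeasurable f)
    (measurePreserving_add_right volume h)

/-- The translate `φ(· - h)` of a Schwartz function. -/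
def shift (h : Plane) (φ : 𝓢(Plane, ℂ)) : 𝓢(Plane, ℂ) := SchwartzMap.compSubConstCLM ℂ h φ

lemma shift_apply (h : Plane) (φ : 𝓢(Plane, ℂ)) (x : Plane) : shift h φ x = φ (x - h) := rfl

lemma integral_translate_mul (h : Plane) (f : L2) (φ : Plane → ℂ) :
    ∫ x, translate h f x * φ x = ∫ x, f x * φ (x - h) := by
  rw [← integral_add_right_eq_self (fun x => f x * φ (x - h)) h]
  refine integral_congr_ae ?_
  filter_upwards [translate_ae h f] with x hx
  rw [hx, add_sub_cancel_right]

lemma laplacian_shift (h : Plane) (φ : 𝓢(Plane, ℂ)) : Δ (shift h φ) = shift h (Δ φ) := by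
  ext x
  rw [shift_apply, SchwartzMap.laplacian_apply, SchwartzMap.laplacian_apply,
    InnerProductSpace.laplacian_eq_iteratedFDeriv_stdOrthonormalBasis,
    InnerProductSpace.laplacian_eq_iteratedFDeriv_stdOrthonormalBasis]
  have : (⇑(shift h φ) : Plane → ℂ) = fun z => φ (z - h) := rfl
  simp only [this, iteratedFDeriv_comp_sub]

/-- The Fourier character `e^{2πi h·ξ}`. -/
def shiftSymbol (h ξ : Plane) : ℂ := Complex.exp (((2 * Real.pi * inner ℝ ξ h : ℝ) : ℂ) * Complex.I)

lemma norm_shiftSymbol (h ξ : Plane) : ‖shiftSymbol h ξ‖ = 1 := Complex.norm_exp_ofReal_mul_I _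

lemma continuous_shiftSymbol (h : Plane) : Continuous (shiftSymbol h) := by
  unfold shiftSymbol; fun_prop

lemma hasTemperateGrowth_shiftSymbol (h : Plane) : (shiftSymbol h).HasTemperateGrowth := by
  have h1 : (fun ξ : Plane => 2 * Real.pi * inner ℝ ξ h).HasTemperateGrowth := by fun_prop
  exact hasTemperateGrowth_cexp_mul_I.comp h1

lemma memLp_shiftSymbol_mul (h : Plane) (f : L2) :
    MemLp (fun ξ => shiftSymbol h ξ * f ξ) 2 volume := by
  refine (Lp.memLp f).of_le
    ((continuous_shiftSymbol h).aestronglyMeasurable.mul (Lp.aestronglyMeasurable f))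
    (Eventually.of_forall fun ξ => ?_)
  rw [norm_mul, norm_shiftSymbol, one_mul]

lemma fourier_shiftSymbol_smul (h : Plane) (χ : 𝓢(Plane, ℂ)) (x : Plane) :
    𝓕 (SchwartzMap.smulLeftCLM ℂ (shiftSymbol h) χ) x = 𝓕 χ (x - h) := by
  rw [SchwartzMap.fourier_coe, SchwartzMap.fourier_coe, Real.fourier_eq', Real.fourier_eq']
  congr 1; ext ξ
  rw [SchwartzMap.smulLeftCLM_apply_apply (hasTemperateGrowth_shiftSymbol h), smul_eq_mul,
    smul_eq_mul, smul_eq_mul, ← mul_assoc, shiftSymbol, ← Complex.exp_add, inner_sub_right]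
  push_cast
  ring_nf

lemma fourier_translate_ae (h : Plane) (f : L2) :
    (𝓕 (translate h f) : L2) =ᵐ[volume] fun ξ => shiftSymbol h ξ * (𝓕 f : L2) ξ := by
  suffices hs : (𝓕 (translate h f) : L2) = (memLp_shiftSymbol_mul h (𝓕 f)).toLp _ by
    rw [hs]; exact MemLp.coeFn_toLp _
  rw [← sub_eq_zero, ← norm_le_zero_iff]
  refine norm_le_of_pairing_toLp_le le_rfl fun χ => ?_
  rw [zero_mul, norm_le_zero_iff, map_sub, sub_apply, sub_eq_zero]
  calc pairing (𝓕 (translate h f)) (χ.toLp 2 volume)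
      = ∫ x, f x * 𝓕 χ (x - h) := by
        rw [pairing_fourier_toLp, pairing_toLp, integral_translate_mul]
    _ = pairing f ((𝓕 (SchwartzMap.smulLeftCLM ℂ (shiftSymbol h) χ)).toLp 2 volume) := by
        rw [pairing_toLp]
        congr 1; ext x
        rw [fourier_shiftSymbol_smul]
    _ = _ := by
        rw [← pairing_fourier_toLp, pairing_toLp, pairing_toLp]
        refine integral_congr_ae ?_
        filter_upwards [MemLp.coeFn_toLp (memLp_shiftSymbol_mul h (𝓕 f))] with ξ hξ
        rw [hξ, SchwartzMap.smulLeftCLM_apply_apply (hasTemperateGrowth_shiftSymbol h), smul_eq_mul]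
        ring

lemma freeProp_translate (t : ℝ) (h : Plane) (f : L2) :
    freeProp t (translate h f) = translate h (freeProp t f) := by
  apply fourier_injective
  apply Lp.ext
  filter_upwards [fourier_freeProp_ae t (translate h f), fourier_translate_ae h f,
    fourier_translate_ae h (freeProp t f), fourier_freeProp_ae t f] with ξ h1 h2 h3 h4
  rw [h1, h2, h3, h4]
  ring

/-- The weight `(1 + |2πξ|²)^{1/2}` of the `H¹` norm. -/
def h1Weight (ξ : Plane) : ℝ := Real.sqrt (1 + (2 * Real.pi * ‖ξ‖) ^ 2)

lemma one_le_h1Weight (ξ : Plane) : 1 ≤ h1Weight ξ := by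
  rw [h1Weight, Real.one_le_sqrt]
  nlinarith [sq_nonneg (2 * Real.pi * ‖ξ‖)]

lemma mul_norm_le_h1Weight (ξ : Plane) : 2 * Real.pi * ‖ξ‖ ≤ h1Weight ξ :=
  Real.le_sqrt_of_sq_le (by linarith)

lemma h1Norm_eq (f : L2) :
    h1Norm f = eLpNorm (fun ξ => (h1Weight ξ : ℂ) * (𝓕 f : L2) ξ) 2 volume := rfl

lemma aestronglyMeasurable_h1Weight_mul (f : L2) :
    AEStronglyMeasurable (fun ξ => (h1Weight ξ : ℂ) * (f : L2) ξ) volume := by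
  refine Continuous.aestronglyMeasurable ?_ |>.mul (Lp.aestronglyMeasurable _)
  unfold h1Weight
  fun_prop

lemma enorm_fourier (f : L2) : ‖(𝓕 f : L2)‖ₑ = ‖f‖ₑ := by
  rw [← ofReal_norm, Lp.norm_fourier_eq, ofReal_norm]

lemma enorm_le_h1Norm (f : L2) : ‖f‖ₑ ≤ h1Norm f := by
  rw [← enorm_fourier, Lp.enorm_def, h1Norm_eq]
  refine eLpNorm_mono fun ξ => ?_
  rw [norm_mul, Complex.norm_real, Real.norm_of_nonneg (zero_le_one.trans (one_le_h1Weight ξ))]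
  exact le_mul_of_one_le_left (norm_nonneg _) (one_le_h1Weight ξ)

lemma h1Norm_freeProp (t : ℝ) (f : L2) : h1Norm (freeProp t f) = h1Norm f := by
  rw [h1Norm_eq, h1Norm_eq]
  refine eLpNorm_congr_norm_ae ?_
  filter_upwards [fourier_freeProp_ae t f] with ξ hξ
  rw [hξ, norm_mul, norm_mul, norm_mul, norm_schrodingerSymbol, one_mul]

lemma h1Norm_add_le (f g : L2) : h1Norm (f + g) ≤ h1Norm f + h1Norm g := by
  have h : (𝓕 (f + g) : L2) = 𝓕 f + 𝓕 g := (Lp.fourierTransformₗᵢ Plane ℂ).map_add f g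
  simp only [h1Norm_eq, h]
  rw [eLpNorm_congr_ae (g := (fun ξ => (h1Weight ξ : ℂ) * (𝓕 f : L2) ξ) +
    fun ξ => (h1Weight ξ : ℂ) * (𝓕 g : L2) ξ)]
  · exact eLpNorm_add_le (aestronglyMeasurable_h1Weight_mul _)
      (aestronglyMeasurable_h1Weight_mul _) (by norm_num)
  · filter_upwards [Lp.coeFn_add (𝓕 f : L2) (𝓕 g)] with ξ hξ
    rw [hξ, Pi.add_apply, Pi.add_apply, mul_add]

lemma lowerSemicontinuous_h1Norm : LowerSemicontinuous h1Norm := by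
  rw [lowerSemicontinuous_iff_isClosed_preimage]
  intro c
  refine isSeqClosed_iff_isClosed.1 ?_
  intro f g hf hfg
  have hF : Tendsto (fun n => (𝓕 (f n) : L2)) atTop (𝓝 (𝓕 g)) :=
    ((Lp.fourierTransformₗᵢ Plane ℂ).continuous.tendsto g).comp hfg
  obtain ⟨ns, -, hns⟩ := (tendstoInMeasure_of_tendsto_Lp hF).exists_seq_tendsto_ae
  refine Lp.eLpNorm_le_of_ae_tendsto (u := atTop)
    (f := fun n ξ => (h1Weight ξ : ℂ) * (𝓕 (f (ns n)) : L2) ξ)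
    (Eventually.of_forall fun n => hf (ns n)) (fun n => aestronglyMeasurable_h1Weight_mul _) ?_
  filter_upwards [hns] with ξ hξ
  exact hξ.const_mul _

lemma fourier_translate_sub_ae (h : Plane) (f : L2) :
    (𝓕 (translate h f - f) : L2) =ᵐ[volume] fun ξ => (shiftSymbol h ξ - 1) * (𝓕 f : L2) ξ := by
  rw [fourier_sub']
  filter_upwards [fourier_translate_ae h f, Lp.coeFn_sub (𝓕 (translate h f) : L2) (𝓕 f)]
    with ξ h1 h2
  rw [h2, Pi.sub_apply, h1, sub_mul, one_mul]

/-- Difference quotients of an `H¹` function are bounded in `L²`. -/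
lemma enorm_translate_sub_le (h : Plane) (f : L2) :
    ‖translate h f - f‖ₑ ≤ ENNReal.ofReal ‖h‖ * h1Norm f := by
  rw [← enorm_fourier, Lp.enorm_def, h1Norm_eq]
  refine eLpNorm_le_mul_eLpNorm_of_ae_le_mul ?_ 2
  filter_upwards [fourier_translate_sub_ae h f] with ξ hξ
  rw [hξ, norm_mul, norm_mul, Complex.norm_real,
    Real.norm_of_nonneg (zero_le_one.trans (one_le_h1Weight ξ)), ← mul_assoc]
  refine mul_le_mul_of_nonneg_right ?_ (norm_nonneg _)
  have h1 : ‖shiftSymbol h ξ - 1‖ ≤ ‖2 * Real.pi * inner ℝ ξ h‖ := by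
    unfold shiftSymbol
    rw [mul_comm]
    exact Real.norm_exp_I_mul_ofReal_sub_one_le
  refine h1.trans ?_
  rw [norm_mul, Real.norm_of_nonneg (by positivity)]
  calc 2 * Real.pi * ‖inner ℝ ξ h‖ ≤ 2 * Real.pi * (‖ξ‖ * ‖h‖) := by
        gcongr; exact norm_inner_le_norm ξ h
    _ = ‖h‖ * (2 * Real.pi * ‖ξ‖) := by ring
    _ ≤ ‖h‖ * h1Weight ξ := by gcongr; exact mul_norm_le_h1Weight ξ

/-- A function whose difference quotients are bounded in `L²` belongs to `H¹`. -/
lemma h1Norm_le_of_translate {g : L2} {M : ℝ≥0∞} (h0 : ‖g‖ₑ ≤ M)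
    (h : ∀ h : Plane, ‖translate h g - g‖ₑ ≤ ENNReal.ofReal ‖h‖ * M) : h1Norm g ≤ 3 * M := by
  have hj : ∀ j : Fin 2, eLpNorm (fun ξ : Plane => ((2 * Real.pi * ξ j : ℝ) : ℂ) * Complex.I *
      (𝓕 g : L2) ξ) 2 volume ≤ M := by
    intro j
    -- difference quotients in the direction of a basis vector, with steps `1 / (n + 1)`
    set e : ℕ → Plane := fun n => (1 / ((n : ℝ) + 1)) • EuclideanSpace.single j (1 : ℝ) with he
    have hen : ∀ n, ‖e n‖ = 1 / ((n : ℝ) + 1) := by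
      intro n
      simp only [he]
      rw [norm_smul, PiLp.norm_single, Real.norm_of_nonneg (by positivity)]
      simp
    refine Lp.eLpNorm_le_of_ae_tendsto (u := atTop)
      (f := fun (n : ℕ) ξ => (((n : ℝ) + 1 : ℝ) : ℂ) * ((shiftSymbol (e n) ξ - 1) * (𝓕 g : L2) ξ))
      (Eventually.of_forall fun n => ?_) (fun n => ?_) ?_
    · have h1 := h (e n)
      rw [← enorm_fourier, Lp.enorm_def, eLpNorm_congr_ae (fourier_translate_sub_ae (e n) g),
        hen] at h1
      have h2 := eLpNorm_const_smul (((n : ℝ) + 1 : ℝ) : ℂ)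
        (fun ξ => (shiftSymbol (e n) ξ - 1) * (𝓕 g : L2) ξ) 2 (volume : Measure Plane)
      refine (le_of_eq h2).trans ((mul_le_mul' le_rfl h1).trans ?_)
      rw [← mul_assoc, ← ofReal_norm, Complex.norm_real, Real.norm_of_nonneg (by positivity),
        ← ENNReal.ofReal_mul (by positivity), mul_one_div_cancel (by positivity),
        ENNReal.ofReal_one, one_mul]
    · exact (((continuous_shiftSymbol _).sub continuous_const).aestronglyMeasurable.mul
        (Lp.aestronglyMeasurable _)).const_mul _
    · refine Eventually.of_forall fun ξ => ?_
      simp only [← mul_assoc]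
      refine Tendsto.mul_const _ ?_
      set θ : ℝ := 2 * Real.pi * ξ j with hθ
      have hsym : ∀ n, shiftSymbol (e n) ξ =
          Complex.exp ((((1 / ((n : ℝ) + 1)) * θ : ℝ) : ℂ) * Complex.I) := by
        intro n
        unfold shiftSymbol
        congr 3
        simp only [he]
        rw [inner_smul_right, EuclideanSpace.inner_single_right]
        simp [hθ]
        ring
      have hd : HasDerivAt (fun r : ℝ => Complex.exp (((r * θ : ℝ) : ℂ) * Complex.I))
          ((θ : ℂ) * Complex.I) 0 := by
        have h1 : HasDerivAt (fun r : ℝ => ((r * θ : ℝ) : ℂ) * Complex.I)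
            ((θ : ℂ) * Complex.I) 0 := by
          have := ((hasDerivAt_id (0 : ℝ)).mul_const θ).ofReal_comp.mul_const Complex.I
          simpa using this
        simpa using h1.cexp
      have ht := hd.tendsto_slope_zero
      have hn : Tendsto (fun n : ℕ => 1 / ((n : ℝ) + 1)) atTop (𝓝[≠] 0) := by
        refine tendsto_nhdsWithin_iff.2 ⟨tendsto_one_div_add_atTop_nhds_zero_nat, ?_⟩
        exact Eventually.of_forall fun n => by
          simp only [Set.mem_compl_iff, Set.mem_singleton_iff]; positivity
      refine (ht.comp hn).congr fun n => ?_
      rw [hsym]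
      simp
  have hw : ∀ ξ : Plane, h1Weight ξ ≤ 1 + |2 * Real.pi * ξ 0| + |2 * Real.pi * ξ 1| := by
    intro ξ
    refine Real.sqrt_le_iff.2 ⟨by positivity, ?_⟩
    rw [mul_pow, EuclideanSpace.norm_sq_eq, Fin.sum_univ_two]
    simp only [Real.norm_eq_abs, sq_abs]
    nlinarith [abs_nonneg (2 * Real.pi * ξ 0), abs_nonneg (2 * Real.pi * ξ 1),
      sq_abs (2 * Real.pi * ξ 0), sq_abs (2 * Real.pi * ξ 1),
      mul_nonneg (abs_nonneg (2 * Real.pi * ξ 0)) (abs_nonneg (2 * Real.pi * ξ 1))]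
  have hm : ∀ j : Fin 2, AEStronglyMeasurable (fun ξ : Plane => ((2 * Real.pi * ξ j : ℝ) : ℂ) *
      Complex.I * (𝓕 g : L2) ξ) volume := fun j =>
    (Continuous.aestronglyMeasurable (by fun_prop)).mul (Lp.aestronglyMeasurable _)
  rw [h1Norm_eq]
  set p : Fin 2 → Plane → ℝ := fun j ξ =>
    ‖((2 * Real.pi * ξ j : ℝ) : ℂ) * Complex.I * (𝓕 g : L2) ξ‖ with hp
  have h1 : eLpNorm (fun ξ => (h1Weight ξ : ℂ) * (𝓕 g : L2) ξ) 2 volume ≤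
      eLpNorm ((fun ξ => ‖(𝓕 g : L2) ξ‖) + p 0 + p 1) 2 volume := by
    refine eLpNorm_mono_real fun ξ => ?_
    simp only [Pi.add_apply, hp, norm_mul, Complex.norm_real, Complex.norm_I, mul_one]
    rw [Real.norm_of_nonneg (zero_le_one.trans (one_le_h1Weight ξ))]
    have := mul_le_mul_of_nonneg_right (hw ξ) (norm_nonneg ((𝓕 g : L2) ξ))
    simp only [Real.norm_eq_abs, abs_mul] at this ⊢
    linarith
  have hm0 : AEStronglyMeasurable (fun ξ => ‖(𝓕 g : L2) ξ‖) volume :=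
    (Lp.aestronglyMeasurable _).norm
  refine h1.trans ((eLpNorm_add_le (hm0.add (hm 0).norm) (hm 1).norm (by norm_num)).trans ?_)
  have h2 := eLpNorm_add_le hm0 (hm 0).norm (p := 2) (by norm_num)
  have h3 : eLpNorm (fun ξ => ‖(𝓕 g : L2) ξ‖) 2 volume ≤ M := by
    rw [eLpNorm_norm, ← Lp.enorm_def, enorm_fourier]
    exact h0
  have h4 : ∀ j, eLpNorm (p j) 2 volume ≤ M := fun j => by
    simp only [hp]
    rw [eLpNorm_norm]
    exact hj j
  calc _ ≤ M + M + M := add_le_add (h2.trans (add_le_add h3 (h4 0))) (h4 1)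
    _ = 3 * M := by ring

/-! ### The nonlinearity -/

lemma lintegral_mul_le_sq_mul_sq {α : Type*} [MeasurableSpace α] {μ : Measure α}
    {f g : α → ℝ≥0∞} (hf : AEMeasurable f μ) (hg : AEMeasurable g μ) :
    ∫⁻ x, f x * g x ∂μ ≤ (∫⁻ x, f x ^ 2 ∂μ) ^ (1 / 2 : ℝ) * (∫⁻ x, g x ^ 2 ∂μ) ^ (1 / 2 : ℝ) := by
  have hpq : (2 : ℝ).HolderConjugate 2 := by
    rw [Real.holderConjugate_iff]; norm_num
  have h := ENNReal.lintegral_mul_le_Lp_mul_Lq μ hpq hf hg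
  simp only [Pi.mul_apply] at h
  exact_mod_cast h

/-- Hölder's inequality with exponents `1 = 4/8 + 1/4 + 1/4`. -/
lemma lintegral_pow_four_mul_le {a w φ : Plane → ℂ} (ha : AEStronglyMeasurable a volume)
    (hw : AEStronglyMeasurable w volume) (hφ : AEStronglyMeasurable φ volume) :
    ∫⁻ x, ‖a x‖ₑ ^ 4 * (‖w x‖ₑ * ‖φ x‖ₑ) ≤
      eLpNorm a 8 volume ^ 4 * eLpNorm w 4 volume * eLpNorm φ 4 volume := by
  have hroot : ∀ (y : ℝ≥0∞) (n : ℕ), (y ^ (2 * n)) ^ (1 / 2 : ℝ) = y ^ n := by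
    intro y n
    rw [← ENNReal.rpow_natCast, ← ENNReal.rpow_mul, ← ENNReal.rpow_natCast]
    congr 1
    push_cast
    ring
  have h1 := lintegral_mul_le_sq_mul_sq (μ := volume) (ha.enorm.pow_const 4)
    (hw.enorm.mul hφ.enorm)
  have h2 := lintegral_mul_le_sq_mul_sq (μ := volume) (hw.enorm.pow_const 2) (hφ.enorm.pow_const 2)
  simp only [← pow_mul, Pi.mul_apply, mul_pow] at h1 h2
  norm_num only at h1 h2
  rw [← eLpNorm_eight_pow, show (8 : ℕ) = 2 * 4 by norm_num, hroot] at h1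
  rw [← eLpNorm_four_pow, ← eLpNorm_four_pow, show (4 : ℕ) = 2 * 2 by norm_num, hroot, hroot,
    ← mul_pow] at h2
  have h3 := ENNReal.rpow_le_rpow h2 (show (0 : ℝ) ≤ 1 / 2 by norm_num)
  have h4 := hroot (eLpNorm w 4 volume * eLpNorm φ 4 volume) 1
  rw [mul_one, pow_one] at h4
  rw [h4] at h3
  rw [mul_assoc]
  exact h1.trans (mul_le_mul' le_rfl h3)

/-- The quintic nonlinearity `|z|⁴ z`. -/
def quintic (z : ℂ) : ℂ := ((‖z‖ ^ 4 : ℝ) : ℂ) * z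

lemma continuous_quintic : Continuous quintic := by
  unfold quintic; fun_prop

lemma norm_quintic_sub_le (z w : ℂ) :
    ‖quintic z - quintic w‖ ≤ 5 * (‖z‖ ^ 4 + ‖w‖ ^ 4) * ‖z - w‖ := by
  have e : quintic z - quintic w = ((‖z‖ ^ 4 : ℝ) : ℂ) * (z - w) +
      ((‖z‖ ^ 4 - ‖w‖ ^ 4 : ℝ) : ℂ) * w := by
    unfold quintic; push_cast; ring
  set p := ‖z‖ with hp
  set q := ‖w‖ with hq
  have hp0 : 0 ≤ p := norm_nonneg z
  have hq0 : 0 ≤ q := norm_nonneg w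
  have h1 : |p - q| ≤ ‖z - w‖ := abs_norm_sub_norm_le z w
  have h2 : |p ^ 4 - q ^ 4| ≤ ‖z - w‖ * (p ^ 3 + p ^ 2 * q + p * q ^ 2 + q ^ 3) := by
    rw [show p ^ 4 - q ^ 4 = (p - q) * (p ^ 3 + p ^ 2 * q + p * q ^ 2 + q ^ 3) by ring, abs_mul,
      abs_of_nonneg (by positivity : 0 ≤ p ^ 3 + p ^ 2 * q + p * q ^ 2 + q ^ 3)]
    exact mul_le_mul_of_nonneg_right h1 (by positivity)
  have h3 : (p ^ 3 + p ^ 2 * q + p * q ^ 2 + q ^ 3) * q ≤ 4 * (p ^ 4 + q ^ 4) := by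
    rcases le_total p q with h | h
    · have a1 : p ^ 3 * q ≤ q ^ 3 * q := by gcongr
      have a2 : p ^ 2 * q * q ≤ q ^ 2 * q * q := by gcongr
      have a3 : p * q ^ 2 * q ≤ q * q ^ 2 * q := by gcongr
      nlinarith [pow_nonneg hp0 4]
    · have a1 : p ^ 3 * q ≤ p ^ 3 * p := by gcongr
      have a2 : p ^ 2 * q * q ≤ p ^ 2 * p * p := by gcongr
      have a3 : p * q ^ 2 * q ≤ p * p ^ 2 * p := by gcongr
      nlinarith [pow_nonneg hq0 4]
  rw [e]
  refine (norm_add_le _ _).trans ?_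
  rw [norm_mul, norm_mul, Complex.norm_real, Complex.norm_real, Real.norm_of_nonneg (by positivity),
    Real.norm_eq_abs, ← hq]
  calc p ^ 4 * ‖z - w‖ + |p ^ 4 - q ^ 4| * q
      ≤ p ^ 4 * ‖z - w‖ + ‖z - w‖ * (p ^ 3 + p ^ 2 * q + p * q ^ 2 + q ^ 3) * q := by gcongr
    _ = p ^ 4 * ‖z - w‖ + ‖z - w‖ * ((p ^ 3 + p ^ 2 * q + p * q ^ 2 + q ^ 3) * q) := by ring
    _ ≤ p ^ 4 * ‖z - w‖ + ‖z - w‖ * (4 * (p ^ 4 + q ^ 4)) := by gcongr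
    _ ≤ _ := by nlinarith [norm_nonneg (z - w), mul_nonneg (norm_nonneg (z - w)) (pow_nonneg hq0 4)]

lemma enorm_quintic (z : ℂ) : ‖quintic z‖ₑ = ‖z‖ₑ ^ 4 * ‖z‖ₑ := by
  unfold quintic
  rw [enorm_mul]
  congr 1
  rw [← ofReal_norm, Complex.norm_real, Real.norm_of_nonneg (by positivity),
    ENNReal.ofReal_pow (norm_nonneg _), ofReal_norm]

lemma enorm_quintic_sub_le (z w : ℂ) :
    ‖quintic z - quintic w‖ₑ ≤ 5 * (‖z‖ₑ ^ 4 + ‖w‖ₑ ^ 4) * ‖z - w‖ₑ := by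
  simp only [← ofReal_norm]
  rw [← ENNReal.ofReal_pow (norm_nonneg _), ← ENNReal.ofReal_pow (norm_nonneg _),
    ← ENNReal.ofReal_add (by positivity) (by positivity),
    show (5 : ℝ≥0∞) = ENNReal.ofReal 5 by simp, ← ENNReal.ofReal_mul (by positivity),
    ← ENNReal.ofReal_mul (by positivity)]
  exact ENNReal.ofReal_le_ofReal (norm_quintic_sub_le z w)

/-- Interpolation of `L⁴` between `L²` and `L⁸`. -/
lemma eLpNorm_four_pow_le (f : L2) :
    eLpNorm f 4 volume ^ 4 ≤ ‖f‖ₑ ^ 2 + eLpNorm f 8 volume ^ 8 := by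
  rw [eLpNorm_four_pow, eLpNorm_eight_pow, Lp.enorm_def, eLpNorm_two_sq,
    ← lintegral_add_left' ((Lp.aestronglyMeasurable f).enorm.pow_const 2)]
  refine lintegral_mono fun x => ?_
  rcases le_total ‖f x‖ₑ 1 with h | h
  · exact (pow_le_pow_right_of_le_one' h (by norm_num : 2 ≤ 4)).trans le_self_add
  · exact (pow_le_pow_right' h (by norm_num : 4 ≤ 8)).trans le_add_self

lemma enorm_integral_quintic_mul_le (f : L2) (φ : 𝓢(Plane, ℂ)) :
    ‖∫ x, quintic (f x) * φ x‖ₑ ≤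
      eLpNorm f 8 volume ^ 4 * eLpNorm f 4 volume * eLpNorm φ 4 volume := by
  refine (enorm_integral_le_lintegral_enorm _).trans (le_trans (le_of_eq ?_)
    (lintegral_pow_four_mul_le (Lp.aestronglyMeasurable f) (Lp.aestronglyMeasurable f)
      φ.continuous.aestronglyMeasurable))
  refine lintegral_congr fun x => ?_
  rw [enorm_mul, enorm_quintic, mul_assoc]

lemma eLpNorm_four_schwartz_ne_top (φ : 𝓢(Plane, ℂ)) : eLpNorm φ 4 volume ≠ ∞ :=
  (φ.memLp 4 volume).2.ne

lemma integrable_quintic_mul {f : L2} (hf : eLpNorm f 8 volume ≠ ∞) (φ : 𝓢(Plane, ℂ)) :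
    Integrable fun x => quintic (f x) * φ x := by
  refine ⟨(continuous_quintic.comp_aestronglyMeasurable (Lp.aestronglyMeasurable f)).mul
    φ.continuous.aestronglyMeasurable, ?_⟩
  have h4 : eLpNorm f 4 volume ≠ ∞ := by
    intro h
    have := eLpNorm_four_pow_le f
    rw [h, ENNReal.top_pow (by norm_num), top_le_iff] at this
    exact ENNReal.add_ne_top.2 ⟨by simp, ENNReal.pow_ne_top hf⟩ this
  refine lt_of_le_of_lt ?_ (ENNReal.mul_ne_top (ENNReal.mul_ne_top (ENNReal.pow_ne_top hf (n := 4))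
    h4) (eLpNorm_four_schwartz_ne_top φ)).lt_top
  refine le_trans (le_of_eq ?_)
    (lintegral_pow_four_mul_le (Lp.aestronglyMeasurable f) (Lp.aestronglyMeasurable f)
      φ.continuous.aestronglyMeasurable)
  refine lintegral_congr fun x => ?_
  rw [enorm_mul, enorm_quintic, mul_assoc]

/-- The nonlinearity of the translate minus the nonlinearity, as a functional on test functions. The
translation is put on the test function, as it appears in the equation for the translate. -/
lemma enorm_integral_quintic_translate_sub_le {f : L2} (hf : eLpNorm f 8 volume ≠ ∞) (h : Plane)
    (φ : 𝓢(Plane, ℂ)) :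
    ‖(∫ x, quintic (f x) * shift h φ x) - ∫ x, quintic (f x) * φ x‖ₑ ≤
      10 * eLpNorm f 8 volume ^ 4 * eLpNorm (translate h f - f : L2) 4 volume *
        eLpNorm φ 4 volume := by
  have hf' : eLpNorm (translate h f) 8 volume ≠ ∞ := by rwa [eLpNorm_translate]
  have e1 : ∫ x, quintic (f x) * shift h φ x = ∫ x, quintic (translate h f x) * φ x := by
    rw [← integral_add_right_eq_self (fun x => quintic (f x) * shift h φ x) h]
    refine integral_congr_ae ?_
    filter_upwards [translate_ae h f] with x hx
    rw [hx, shift_apply, add_sub_cancel_right]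
  rw [e1, ← integral_sub (integrable_quintic_mul hf' φ) (integrable_quintic_mul hf φ)]
  refine (enorm_integral_le_lintegral_enorm _).trans ?_
  have hpt : ∀ᵐ x, ‖quintic (translate h f x) * φ x - quintic (f x) * φ x‖ₑ ≤
      5 * (‖translate h f x‖ₑ ^ 4 * (‖(translate h f - f : L2) x‖ₑ * ‖φ x‖ₑ)) +
      5 * (‖f x‖ₑ ^ 4 * (‖(translate h f - f : L2) x‖ₑ * ‖φ x‖ₑ)) := by
    filter_upwards [Lp.coeFn_sub (translate h f) f] with x hx
    rw [← sub_mul, enorm_mul, hx, Pi.sub_apply]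
    refine (mul_le_mul' (enorm_quintic_sub_le _ _) le_rfl).trans (le_of_eq ?_)
    ring
  refine (lintegral_mono_ae hpt).trans ?_
  have hφ : AEStronglyMeasurable φ (volume : Measure Plane) := φ.continuous.aestronglyMeasurable
  have hm := Lp.aestronglyMeasurable (translate h f - f : L2)
  have hm1 : AEMeasurable (fun x => 5 * (‖translate h f x‖ₑ ^ 4 *
      (‖(translate h f - f : L2) x‖ₑ * ‖φ x‖ₑ))) volume :=
    (((Lp.aestronglyMeasurable (translate h f)).enorm.pow_const 4).mul
      (hm.enorm.mul hφ.enorm)).const_mul 5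
  rw [lintegral_add_left' hm1, lintegral_const_mul' _ _ (by norm_num),
    lintegral_const_mul' _ _ (by norm_num)]
  have b1 := lintegral_pow_four_mul_le (Lp.aestronglyMeasurable (translate h f)) hm hφ
  have b2 := lintegral_pow_four_mul_le (Lp.aestronglyMeasurable f) hm hφ
  rw [eLpNorm_translate] at b1
  refine (add_le_add (mul_le_mul' le_rfl b1) (mul_le_mul' le_rfl b2)).trans (le_of_eq ?_)
  ring

/-! ### Scattering -/

lemma IsSolution.continuousOn {I : Set ℝ} {u₀ : L2} {u : ℝ → L2} (hu : IsSolution I u₀ u) :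
    ContinuousOn u I := by
  intro t ht
  rw [ContinuousWithinAt, tendsto_iff_edist_tendsto_0]
  refine tendsto_of_tendsto_of_tendsto_of_le_of_le tendsto_const_nhds (hu.cont t ht)
    (fun _ => zero_le) fun s => ?_
  rw [edist_eq_enorm_sub]
  exact enorm_le_h1Norm _

lemma profile_translate_sub (u : ℝ → L2) (h : Plane) (t : ℝ) :
    profile (fun s => translate h (u s) - u s) t = translate h (profile u t) - profile u t := by
  simp only [profile]
  rw [freeProp_sub, freeProp_translate]

lemma eLpNorm_translate_sub_four_pow_le (h : Plane) (f : L2) :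
    eLpNorm (translate h f - f : L2) 4 volume ^ 4 ≤ 16 * eLpNorm f 4 volume ^ 4 := by
  rw [show (16 : ℝ≥0∞) = 2 ^ 4 by norm_num, ← mul_pow]
  gcongr
  rw [eLpNorm_congr_ae (Lp.coeFn_sub _ _)]
  refine (eLpNorm_sub_le (Lp.aestronglyMeasurable _) (Lp.aestronglyMeasurable _)
    (by norm_num)).trans ?_
  rw [eLpNorm_translate, two_mul]

/-- Wherever the `L⁸` norm in space-time of the solution is small, the increments of the profile
are small in `H¹`. The bound in `L²` is applied to the solution and, instead of differentiating
the equation, to the differences between its translates and itself. -/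
theorem h1Norm_profile_sub_le {I : Set ℝ} {u₀ : L2} {u : ℝ → L2} (hu : IsSolution I u₀ u)
    {B : ℝ≥0} (hB : ∀ t ∈ I, h1Norm (u t) ≤ B) {a b : ℝ} (hab : a ≤ b) (hI : Set.Icc a b ⊆ I)
    (hsmall : 10 * (∫⁻ t in Set.Icc a b, eLpNorm (u t) 8 volume ^ 8) ^ (1 / 2 : ℝ) ≤
      ENNReal.ofReal (1 / 20))
    {s t : ℝ} (hs : s ∈ Set.Icc a b) (ht : t ∈ Set.Icc a b) :
    h1Norm (profile u t - profile u s) ≤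
      3 * (10 * (∫⁻ t in Set.Icc a b, eLpNorm (u t) 8 volume ^ 8) ^ (1 / 2 : ℝ) * (4 * B)) := by
  set A : ℝ≥0∞ := ∫⁻ t in Set.Icc a b, eLpNorm (u t) 8 volume ^ 8 with hA
  have hcont : ContinuousOn u (Set.Icc a b) := hu.continuousOn.mono hI
  have ha : a ∈ I := hI ⟨le_rfl, hab⟩
  have hAfin : A ≠ ∞ := by
    intro h
    rw [h, ENNReal.top_rpow_of_pos (by norm_num), ENNReal.mul_top (by norm_num)] at hsmall
    exact absurd hsmall (by simp)
  have h8m := aemeasurable_eLpNorm_of_continuousOn measurableSet_Icc hcont 8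
  have h8fin : ∀ᵐ t ∂(volume.restrict (Set.Icc a b)), eLpNorm (u t) 8 volume ≠ ∞ := by
    filter_upwards [ae_lt_top' (h8m.pow_const 8) hAfin] with t ht h
    rw [h] at ht
    simp at ht
  have hL2 : ∀ t ∈ Set.Icc a b, ‖u t‖ₑ ≤ B := fun t ht =>
    (enorm_le_h1Norm _).trans (hB t (hI ht))
  have h4fin : ∫⁻ t in Set.Icc a b, eLpNorm (u t) 4 volume ^ 4 ≠ ∞ := by
    have h1 : ∫⁻ t in Set.Icc a b, eLpNorm (u t) 4 volume ^ 4 ≤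
        ∫⁻ t in Set.Icc a b, ((B : ℝ≥0∞) ^ 2 + eLpNorm (u t) 8 volume ^ 8) :=
      setLIntegral_mono' measurableSet_Icc fun t ht =>
        (eLpNorm_four_pow_le (u t)).trans (by gcongr; exact hL2 t ht)
    rw [lintegral_add_left measurable_const, setLIntegral_const, Real.volume_Icc] at h1
    refine (h1.trans_lt ?_).ne
    exact ENNReal.add_lt_top.2 ⟨ENNReal.mul_lt_top (by simp) ENNReal.ofReal_lt_top, hAfin.lt_top⟩
  set k : ℝ → ℝ≥0∞ := fun t => 10 * eLpNorm (u t) 8 volume ^ 4 with hk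
  have hkm : AEMeasurable k (volume.restrict (Set.Icc a b)) := (h8m.pow_const 4).const_mul 10
  have hk2 : (∫⁻ t in Set.Icc a b, k t ^ 2) ^ (1 / 2 : ℝ) = 10 * A ^ (1 / 2 : ℝ) := by
    simp only [hk, mul_pow, ← pow_mul]
    norm_num only
    rw [lintegral_const_mul' _ _ (by norm_num), ENNReal.mul_rpow_of_nonneg _ _ (by norm_num)]
    congr 1
    rw [show (100 : ℝ≥0∞) = 10 ^ (2 : ℝ) by norm_num, ← ENNReal.rpow_mul]
    norm_num
  rw [← hk2] at hsmall ⊢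
  refine h1Norm_le_of_translate ?_ fun h => ?_
  · refine (enorm_profile_sub_le_of_small (v := u)
      (D := fun φ t => ∫ x, quintic (u t x) * φ x) hab hcont
      (fun φ t ht => (hu.equation φ t (hI ht)).mono hI) hkm ?_ h4fin hsmall hs ht).trans ?_
    · refine Eventually.of_forall fun t φ => (enorm_integral_quintic_mul_le (u t) φ).trans ?_
      refine mul_le_mul' (mul_le_mul' ?_ le_rfl) le_rfl
      exact le_mul_of_one_le_left zero_le (by norm_num)
    · gcongr
      exact hL2 a ⟨le_rfl, hab⟩
  · rw [map_sub, sub_sub_sub_comm, ← profile_translate_sub, ← profile_translate_sub]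
    refine (enorm_profile_sub_le_of_small (v := fun s => translate h (u s) - u s)
      (D := fun φ t => (∫ x, quintic (u t x) * shift h φ x) - ∫ x, quintic (u t x) * φ x) hab
      (((translate h).continuous.comp_continuousOn hcont).sub hcont) ?_ hkm ?_ ?_ hsmall
      hs ht).trans ?_
    · intro φ t ht
      have e1 : ∀ (f : L2) (ψ : 𝓢(Plane, ℂ)), ∫ x, (translate h f - f : L2) x * ψ x =
          (∫ x, f x * shift h ψ x) - ∫ x, f x * ψ x := by
        intro f ψ
        rw [← pairing_toLp, map_sub, sub_apply, pairing_toLp, pairing_toLp, integral_translate_mul]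
        rfl
      simp_rw [e1]
      have h1 := ((hu.equation (shift h φ) t (hI ht)).mono hI).sub
        ((hu.equation φ t (hI ht)).mono hI)
      refine h1.congr_deriv ?_
      rw [laplacian_shift]
      simp only [quintic]
      ring
    · filter_upwards [h8fin] with t ht φ
      exact enorm_integral_quintic_translate_sub_le ht h φ
    · refine ((lintegral_mono fun t => eLpNorm_translate_sub_four_pow_le h (u t)).trans_lt ?_).ne
      rw [lintegral_const_mul' _ _ (by norm_num)]
      exact ENNReal.mul_lt_top (by norm_num) h4fin.lt_top
    · have h2 : ‖translate h (u a) - u a‖ₑ ≤ ENNReal.ofReal ‖h‖ * B :=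
        (enorm_translate_sub_le h (u a)).trans (by gcongr; exact hB a ha)
      calc _ ≤ (∫⁻ t in Set.Icc a b, k t ^ 2) ^ (1 / 2 : ℝ) * (4 * (ENNReal.ofReal ‖h‖ * B)) := by
            gcongr
        _ = _ := by ring

/-- A path whose profile is Cauchy in `H¹` scatters. -/
theorem exists_scattering_state {u : ℝ → L2} {l : Filter ℝ} [l.NeBot]
    (hu : ∀ᶠ t in l, InH1 (u t))
    (hcauchy : ∀ ε : ℝ≥0∞, 0 < ε → ∃ S ∈ l, ∀ s ∈ S, ∀ t ∈ S,
      h1Norm (profile u t - profile u s) ≤ ε) :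
    ∃ φ : L2, InH1 φ ∧ Tendsto (fun t => h1Norm (u t - freeProp t φ)) l (𝓝 0) := by
  have hC : Cauchy (map (profile u) l) := by
    rw [EMetric.cauchy_iff]
    refine ⟨(inferInstance : (map (profile u) l).NeBot).ne, fun ε hε => ?_⟩
    obtain ⟨δ, hδ0, hδ⟩ := exists_between hε
    obtain ⟨S, hS, h⟩ := hcauchy δ hδ0
    refine ⟨profile u '' S, image_mem_map hS, ?_⟩
    rintro _ ⟨s, hs, rfl⟩ _ ⟨t, ht, rfl⟩
    rw [edist_eq_enorm_sub]
    exact ((enorm_le_h1Norm _).trans (h t ht s hs)).trans_lt hδ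
  obtain ⟨φ, hφ⟩ := CompleteSpace.complete hC
  have hφ' : Tendsto (profile u) l (𝓝 φ) := hφ
  have hlim : ∀ ε : ℝ≥0∞, 0 < ε → ∃ S ∈ l, ∀ t ∈ S, h1Norm (profile u t - φ) ≤ ε := by
    intro ε hε
    obtain ⟨S, hS, h⟩ := hcauchy ε hε
    refine ⟨S, hS, fun t ht => ?_⟩
    have hc : IsClosed {g : L2 | h1Norm (profile u t - g) ≤ ε} :=
      (lowerSemicontinuous_h1Norm.isClosed_preimage ε).preimage
        (continuous_const.sub continuous_id : Continuous fun g : L2 => profile u t - g)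
    exact hc.mem_of_tendsto hφ' (by filter_upwards [hS] with s hs using h s hs t ht)
  have hnorm : ∀ t, h1Norm (u t - freeProp t φ) = h1Norm (profile u t - φ) := by
    intro t
    rw [← h1Norm_freeProp t (profile u t - φ), freeProp_sub, freeProp_profile]
  refine ⟨φ, ?_, ?_⟩
  · obtain ⟨S, hS, h⟩ := hlim 1 one_pos
    obtain ⟨t, ht, hut⟩ := (hu.and hS).exists
    rw [inH1_iff] at ht ⊢
    have e : φ = profile u t + (-1 : ℂ) • (profile u t - φ) := by
      rw [neg_one_smul]; abel
    have hneg : ∀ g : L2, h1Norm ((-1 : ℂ) • g) = h1Norm g := by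
      intro g
      have h1 : (𝓕 ((-1 : ℂ) • g) : L2) = (-1 : ℂ) • 𝓕 g :=
        (Lp.fourierTransformₗᵢ Plane ℂ).map_smul _ g
      rw [h1Norm_eq, h1Norm_eq, h1]
      refine eLpNorm_congr_norm_ae ?_
      filter_upwards [Lp.coeFn_smul (-1 : ℂ) (𝓕 g : L2)] with ξ hξ
      rw [hξ]
      simp
    rw [e]
    refine (h1Norm_add_le _ _).trans_lt (ENNReal.add_lt_top.2 ⟨?_, ?_⟩)
    · rwa [profile, h1Norm_freeProp]
    · rw [hneg]
      exact (h t hut).trans_lt ENNReal.one_lt_top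
  · rw [ENNReal.tendsto_nhds_zero]
    intro ε hε
    obtain ⟨S, hS, h⟩ := hlim ε hε
    filter_upwards [hS] with t ht
    rw [hnorm]
    exact h t ht

/-- The Strichartz norm controls the `L⁸` norm in space-time, since the pair `(8, 8)` is
admissible. -/
lemma lintegral_eLpNorm_eight_ne_top {ap : ℝ} (hap4 : 4 < ap) (hap6 : ap ≤ 6) {I : Set ℝ}
    {u : ℝ → L2} (h : strichartzNorm ap I u < ∞) :
    ∫⁻ t in I, eLpNorm (u t) 8 volume ^ 8 ≠ ∞ := by
  have hadm : Admissible (1 / 2) 8 8 := by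
    refine ⟨?_, by norm_num, by norm_num, by norm_num⟩
    rw [show (1 - 1 / 2 : ℝ) = 1 / 2 by norm_num]
    rw [ENNReal.div_add_div_same, ← ENNReal.toReal_eq_toReal_iff' (by finiteness) (by finiteness)]
    rw [ENNReal.toReal_ofReal (by norm_num)]
    norm_num [ENNReal.toReal_add]
  have h8 : (8 : ℝ≥0∞) = ENNReal.ofReal 8 := by simp
  have h1 : ENNReal.ofReal ap ≤ 8 := by
    rw [h8]; exact ENNReal.ofReal_le_ofReal (by linarith)
  have h2 : (8 : ℝ≥0∞) ≤ ENNReal.ofReal (plusDual 4 ap) := by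
    rw [h8]
    apply ENNReal.ofReal_le_ofReal
    rw [plusDual, le_div_iff₀ (by linarith)]
    linarith
  have h3 : mixedNorm I 8 8 u ≤ strichartzNorm ap I u := by
    unfold strichartzNorm
    exact le_iSup_of_le 8 (le_iSup_of_le 8 (le_iSup_of_le hadm (le_iSup_of_le h1
      (le_iSup_of_le ⟨h1, h2⟩ le_rfl))))
  have h4 := eLpNorm_eight_pow (volume.restrict I) (fun t => eLpNorm (u t) 8 volume)
  simp only [enorm_eq_self] at h4
  rw [← h4]
  exact ENNReal.pow_ne_top (h3.trans_lt h).ne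

/-- A bounded `H¹` solution with finite `L⁸` norm in space-time scatters along every filter
generated by intervals that shrink to the empty set; for half-lines these are their two ends. -/
theorem IsSolution.scatters {I : Set ℝ} {u₀ : L2} {u : ℝ → L2} (hu : IsSolution I u₀ u)
    {B : ℝ≥0} (hB : ∀ t ∈ I, h1Norm (u t) ≤ B)
    (h8 : ∫⁻ t in I, eLpNorm (u t) 8 volume ^ 8 ≠ ∞) {l : Filter ℝ} [l.NeBot] {K : ℕ → Set ℝ}
    (hKl : ∀ n, K n ∈ l) (hKI : ∀ n, K n ⊆ I) (hKm : ∀ n, MeasurableSet (K n))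
    (hKc : ∀ n, (K n).OrdConnected) (hKa : Antitone K) (hK : ⋂ n, K n = ∅) :
    ∃ φ : L2, InH1 φ ∧ Tendsto (fun t => h1Norm (u t - freeProp t φ)) l (𝓝 0) := by
  set f : ℝ → ℝ≥0∞ := fun t => eLpNorm (u t) 8 volume ^ 8 with hf
  have htail : Tendsto (fun n => ∫⁻ t in K n, f t) atTop (𝓝 0) := by
    set μ : Measure ℝ := (volume.restrict I).withDensity f with hμ
    have e : ∀ n, μ (K n) = ∫⁻ t in K n, f t := fun n => by
      rw [hμ, withDensity_apply _ (hKm n), Measure.restrict_restrict_of_subset (hKI n)]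
    have h1 := tendsto_measure_iInter_atTop (μ := μ) (fun n => (hKm n).nullMeasurableSet) hKa
      ⟨0, by rw [e]; exact ne_top_of_le_ne_top h8 (lintegral_mono_set (hKI 0))⟩
    simpa only [e, hK, measure_empty, Function.comp_def] using h1
  have hroot : Tendsto (fun n => 10 * (∫⁻ t in K n, f t) ^ (1 / 2 : ℝ)) atTop (𝓝 0) := by
    have h1 := ((ENNReal.continuous_rpow_const (y := 1 / 2)).tendsto 0).comp htail
    rw [ENNReal.zero_rpow_of_pos (by norm_num)] at h1
    simpa using ENNReal.Tendsto.const_mul h1 (Or.inr (by norm_num : (10 : ℝ≥0∞) ≠ ∞))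
  have hbound : Tendsto (fun n => 3 * (10 * (∫⁻ t in K n, f t) ^ (1 / 2 : ℝ) * (4 * B)))
      atTop (𝓝 0) := by
    have h1 := ENNReal.Tendsto.mul_const hroot
      (Or.inr (by finiteness : (4 * B : ℝ≥0∞) ≠ ∞))
    simpa using ENNReal.Tendsto.const_mul h1 (Or.inr (by norm_num : (3 : ℝ≥0∞) ≠ ∞))
  refine exists_scattering_state (by filter_upwards [hKl 0] with t ht using hu.mem t (hKI 0 ht))
    fun ε hε => ?_
  obtain ⟨n, hn1, hn2⟩ := ((hroot.eventually_le_const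
    (by simp : (0 : ℝ≥0∞) < ENNReal.ofReal (1 / 20))).and (hbound.eventually_le_const hε)).exists
  refine ⟨K n, hKl n, fun s hs t ht => ?_⟩
  have hsub : Set.uIcc s t ⊆ K n := (hKc n).uIcc_subset hs ht
  have hA : ∫⁻ r in Set.Icc (s ⊓ t) (s ⊔ t), f r ≤ ∫⁻ r in K n, f r := lintegral_mono_set hsub
  refine (h1Norm_profile_sub_le hu hB inf_le_sup (hsub.trans (hKI n)) (le_trans ?_ hn1)
    Set.left_mem_uIcc Set.right_mem_uIcc).trans (le_trans ?_ hn2)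
  all_goals gcongr

end QuinticNLS

end

theorem mainTheorem12 (ap : ℝ) (hap4 : 4 < ap) (hap6 : ap ≤ 6)
    (u₀ : QuinticNLS.L2) (hu₀ : QuinticNLS.InH1 u₀) (u : ℝ → QuinticNLS.L2) :
    (QuinticNLS.IsSolution (Set.Ici 0) u₀ u →
      QuinticNLS.strichartzNorm ap (Set.Ici 0) u < ∞ →
      ∀ B : ℝ≥0, (∀ t ∈ Set.Ici (0 : ℝ), QuinticNLS.h1Norm (u t) ≤ B) →
      ∃ φ : QuinticNLS.L2, QuinticNLS.InH1 φ ∧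
        Tendsto (fun t : ℝ => QuinticNLS.h1Norm (u t - QuinticNLS.freeProp t φ)) atTop (𝓝 0)) ∧
    (QuinticNLS.IsSolution (Set.Iic 0) u₀ u →
      QuinticNLS.strichartzNorm ap (Set.Iic 0) u < ∞ →
      ∀ B : ℝ≥0, (∀ t ∈ Set.Iic (0 : ℝ), QuinticNLS.h1Norm (u t) ≤ B) →
      ∃ φ : QuinticNLS.L2, QuinticNLS.InH1 φ ∧
        Tendsto (fun t : ℝ => QuinticNLS.h1Norm (u t - QuinticNLS.freeProp t φ)) atBot (𝓝 0)) := by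
  refine ⟨fun hu hS B hB => ?_, fun hu hS B hB => ?_⟩
  · refine hu.scatters hB (QuinticNLS.lintegral_eLpNorm_eight_ne_top hap4 hap6 hS)
      (K := fun n : ℕ => Set.Ici (n : ℝ)) (fun n => Ici_mem_atTop _)
      (fun n => Set.Ici_subset_Ici.2 n.cast_nonneg) (fun n => measurableSet_Ici)
      (fun n => Set.ordConnected_Ici)
      (fun m n hmn => Set.Ici_subset_Ici.2 (Nat.cast_le.2 hmn)) ?_
    refine Set.eq_empty_of_forall_notMem fun x hx => ?_
    obtain ⟨n, hn⟩ := exists_nat_gt x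
    exact (Set.mem_iInter.1 hx n).not_gt hn
  · refine hu.scatters hB (QuinticNLS.lintegral_eLpNorm_eight_ne_top hap4 hap6 hS)
      (K := fun n : ℕ => Set.Iic (-n : ℝ)) (fun n => Iic_mem_atBot _)
      (fun n => Set.Iic_subset_Iic.2 (by simp)) (fun n => measurableSet_Iic)
      (fun n => Set.ordConnected_Iic)
      (fun m n hmn => Set.Iic_subset_Iic.2 (neg_le_neg (Nat.cast_le.2 hmn))) ?_
    refine Set.eq_empty_of_forall_notMem fun x hx => ?_
    obtain ⟨n, hn⟩ := exists_nat_gt (-x)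
    have := Set.mem_Iic.1 (Set.mem_iInter.1 hx n)
    linarith
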